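/- Let $\mathbb{Q}(t)$ be the field of rational functions in one variable over $\mathbb{Q}$, and let $\mathcal{L}_t$ be the language with symbols $<,+,0,1$ and a unary function symbol $\lambda_q$ for each $q\in\mathbb{Q}(t)$. Let $T_t$ be the $\mathcal{L}_t$-theory consisting of the theory of $(\mathbb{R},<,+,0,1)$ together with axioms stating, for a model with universe $M$: (T1) $(M,+,0,(\lambda_q)_{q\in\mathbb{Q}(t)})$ is a $\mathbb{Q}(t)$-vector space; (T2) for all $\mathbb{Q}$-linearly independent $q_1,\dots,q_m\in\mathbb{Q}(t)$, the image of $x\mapsto(\lambda_{q_1}(x),\dots,\lambda_{q_m}(x))$ is dense in $M^m$. A complete theory has NIP if there are no formula $\varphi(x;y)$ ($x$, $y$ finite tuples of variables), model $\mathcal{M}$ of the theory, and tuples $(a_i)_{i\in\mathbb{N}}$, $(b_J)_{J\subseteq\mathbb{N}}$ from $\mathcal{M}$ such that $\mathcal{M}\models\varphi(a_i;b_J)$ if and only if $i\in J$. A structure has NIP if its complete theory does. The structure $\mathcal{R}_t=(\mathbb{R},<,+,0,1,(\lambda_q)_{q\in\mathbb{Q}(t)})$ is constructed as follows. Choose a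 dense basis $\mathcal{B}$ of $\mathbb{R}$ over $\mathbb{Q}$, a basis $I$ of $\mathbb{Q}(t)$ over $\mathbb{Q}$ with $1\in I$, and injective functions $\tilde f_\gamma: I\to\mathcal{B}$ ($\gamma\in 2^{\aleph_0}$) with pairwise disjoint images covering $\mathcal{B}$, such that for all nonempty open intervals $J_1,\dots,J_m\subseteq\mathbb{R}$ and all pairwise distinct $p_1,\dots,p_m\in I$ there is $\gamma$ with $\tilde f_\gamma(p_i)\in J_i$ for all $i$. Let $f_\gamma:\mathbb{Q}(t)\to\mathbb{R}$ be the $\mathbb{Q}$-linear extension of $\tilde f_\gamma$. Every $a\in\mathbb{R}$ is $\sum_\gamma f_\gamma(p_\gamma)$ for a unique finitely supported family $(p_\gamma)$ in $\mathbb{Q}(t)$; put $\lambda_q(a)=\sum_\gamma f_\gamma(q\,p_\gamma)$. For a structure $\mathcal{R}$ expanding a dense linear order $(R,<)$ without endpoints, where definable means definable with parameters: $\mathcal{R}$ satisfies DC if every definable subset of $R$ has a supremum and an infimum in $R\cup\{\pm\infty\}$; $\mathcal{R}$ satisfies EP if $b\in\operatorname{dcl}(S\cup\{a\})$ whenever $S\subseteq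 R$, $a,b\in R$ and $a\in\operatorname{dcl}(S\cup\{b\})\setminus\operatorname{dcl}(S)$; $\mathcal{R}$ is o-minimal if every definable subset of $R$ is a finite union of points and open intervals with endpoints in $R\cup\{\pm\infty\}$. Theorem. 1. Every completion of $T_t$ (complete satisfiable $\mathcal{L}_t$-theory containing $T_t$) has NIP. 2. Choices as above exist. For all such choices, the structure $\mathcal{R}_t$ is a model of $T_t$, satisfies DC, EP and NIP, and is not o-minimal. 3. Consequently the question of Dolich, Miller and Steinhorn has a negative answer: it is not true that every expansion of an ordered group (even: of a densely ordered abelian group without endpoints) that satisfies DC, EP and NIP is o-minimal. -/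

import Mathlib

open FirstOrder FirstOrder.Language

noncomputable section

/-! ### General model-theoretic notions -/

namespace DenseGraph

universe u v w

/-- A theory has NIP if no partitioned formula `φ(x; y)` has the independence property, that is,
in no model of the theory does `φ` shatter an infinite sequence of tuples: there are no
`(a_i)_{i ∈ ℕ}` and `(b_J)_{J ⊆ ℕ}` such that `φ(a_i; b_J)` holds if and only if `i ∈ J`. -/
def TheoryNIP {L : FirstOrder.Language.{u, v}} (T : L.Theory) : Prop :=
  ∀ (m n : ℕ) (φ : L.Formula (Fin m ⊕ Fin n)),
    ¬ ∃ (M : Theory.ModelType.{u, v, max u v} T) (a : ℕ → Fin m → M) (b : Set ℕ → Fin n → M),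
      ∀ (i : ℕ) (J : Set ℕ), φ.Realize (Sum.elim (a i) (b J)) ↔ i ∈ J

/-- A structure has NIP if its complete theory has NIP. -/
def StructureNIP (L : FirstOrder.Language.{u, v}) (M : Type w) [L.Structure M] : Prop :=
  TheoryNIP (L.completeTheory M)

/-- The inclusion of a linear order `M` into `M ∪ {-∞, +∞}`. -/
def toExt {M : Type w} (x : M) : WithBot (WithTop M) := ((x : WithTop M) : WithBot (WithTop M))

/-- Definable completeness: every definable (with parameters) unary set has a supremum and an
infimum in `M ∪ {-∞, +∞}`. -/
def DefinablyComplete (L : FirstOrder.Language.{u, v}) (M : Type w) [LinearOrder M] [L.Structure M] : Prop :=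
  ∀ S : Set M, (Set.univ : Set M).Definable₁ L S →
    (∃ s : WithBot (WithTop M), IsLUB (toExt '' S) s) ∧
    (∃ s : WithBot (WithTop M), IsGLB (toExt '' S) s)

/-- The definable closure of `A`: the elements `b` such that `{b}` is definable over `A`. -/
def dcl (L : FirstOrder.Language.{u, v}) {M : Type w} [L.Structure M] (A : Set M) : Set M :=
  {b | A.Definable₁ L {b}}

/-- The exchange property for definable closure. -/
def ExchangeProperty (L : FirstOrder.Language.{u, v}) (M : Type w) [L.Structure M] : Prop :=
  ∀ (S : Set M) (a b : M), a ∈ dcl L (S ∪ {b}) \ dcl L S → b ∈ dcl L (S ∪ {a})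

/-- O-minimality: every definable (with parameters) unary set is a finite union of points and open
intervals with endpoints in `M ∪ {-∞, +∞}`. -/
def OMinimal (L : FirstOrder.Language.{u, v}) (M : Type w) [LinearOrder M] [L.Structure M] : Prop :=
  ∀ S : Set M, (Set.univ : Set M).Definable₁ L S →
    ∃ F : Set (Set M), F.Finite ∧ S = ⋃₀ F ∧
      ∀ I ∈ F, (∃ c : M, I = {c}) ∨
        ∃ l r : WithBot (WithTop M), I = {x : M | l < toExt x ∧ toExt x < r}

/-- The assertion that every expansion of a densely ordered abelian group without endpoints which
is definably complete, has the exchange property and has NIP is o-minimal. -/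
def EveryDCEPNIPExpansionIsOMinimal : Prop :=
  ∀ (L : FirstOrder.Language.{0, 0}) (M : Type) [AddCommGroup M] [LinearOrder M] [IsOrderedAddMonoid M]
    [DenselyOrdered M] [NoMinOrder M] [NoMaxOrder M] [L.Structure M],
    (∃ R : L.Relations 2, ∀ x : Fin 2 → M, Structure.RelMap R x ↔ x 0 < x 1) →
    (∃ f : L.Functions 2, ∀ x : Fin 2 → M, Structure.funMap f x = x 0 + x 1) →
    DefinablyComplete L M → ExchangeProperty L M → StructureNIP L M → OMinimal L M

/-! ### The languages -/

/-- Function symbols `0`, `1`, `+`. -/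
inductive GroupFunc : ℕ → Type
  | zero : GroupFunc 0
  | one : GroupFunc 0
  | add : GroupFunc 2

/-- The relation symbol `<`. -/
inductive GroupRel : ℕ → Type
  | lt : GroupRel 2

/-- The language of `(ℝ, <, +, 0, 1)`. -/
abbrev LGroup : FirstOrder.Language := ⟨GroupFunc, GroupRel⟩

/-- A unary function symbol `λ_q` for every rational function `q ∈ ℚ(t)`. -/
inductive ScalarFunc : ℕ → Type
  | smul (q : RatFunc ℚ) : ScalarFunc 1

/-- The language consisting of the symbols `λ_q`. -/
abbrev LScalar : FirstOrder.Language := ⟨ScalarFunc, fun _ => Empty⟩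

/-- The language of `(ℝ, <, +, 0, 1, (λ_q)_{q ∈ ℚ(t)})`. -/
abbrev Lt : FirstOrder.Language := LGroup.sum LScalar

/-- The symbol `0`. -/
def zeroSymb : Lt.Functions 0 := Sum.inl GroupFunc.zero

/-- The symbol `+`. -/
def addSymb : Lt.Functions 2 := Sum.inl GroupFunc.add

/-- The symbol `λ_q`. -/
def smulSymb (q : RatFunc ℚ) : Lt.Functions 1 := Sum.inr (ScalarFunc.smul q)

/-- The symbol `<`. -/
def ltSymb : Lt.Relations 2 := Sum.inl GroupRel.lt

/-- The ordered additive group of real numbers with distinguished element `1`. -/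
instance realGroupStructure : LGroup.Structure ℝ where
  funMap
    | GroupFunc.zero, _ => 0
    | GroupFunc.one, _ => 1
    | GroupFunc.add, x => x 0 + x 1
  RelMap
    | GroupRel.lt, x => x 0 < x 1

/-! ### The theory -/

section Theory

variable {α : Type}

/-- The term `0`. -/
def zeroT : Lt.Term α := Term.func zeroSymb ![]

/-- The term `s + t`. -/
def addT (s t : Lt.Term α) : Lt.Term α := Term.func addSymb ![s, t]

/-- The term `λ_q(s)`. -/
def smulT (q : RatFunc ℚ) (s : Lt.Term α) : Lt.Term α :=
  Term.func (smulSymb q) ![s]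

/-- The formula `s < t`. -/
def ltF (s t : Lt.Term α) : Lt.Formula α :=
  ltSymb.formula ![s, t]

end Theory

/-- The complete theory of `(ℝ, <, +, 0, 1)`, viewed in the larger language. -/
def baseTheory : Lt.Theory :=
  (LHom.sumInl : LGroup →ᴸ Lt).onTheory (LGroup.completeTheory ℝ)

/-- The universal closure of a formula whose variables are indexed by `Fin k`. -/
def univClosure (k : ℕ) (φ : Lt.Formula (Fin k)) : Lt.Sentence :=
  Formula.iAlls (Fin k) (φ.relabel (Sum.inr : Fin k → Empty ⊕ Fin k))

/-- The axioms stating that `(M, +, 0, (λ_q)_{q ∈ ℚ(t)})` is a vector space over `ℚ(t)`. -/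
inductive VectorSpaceAxiom : Lt.Sentence → Prop
  /-- `(x + y) + z = x + (y + z)` -/
  | add_assoc : VectorSpaceAxiom (univClosure 3
      ((addT (addT (.var 0) (.var 1)) (.var 2)).equal (addT (.var 0) (addT (.var 1) (.var 2)))))
  /-- `x + y = y + x` -/
  | add_comm : VectorSpaceAxiom (univClosure 2
      ((addT (.var 0) (.var 1)).equal (addT (.var 1) (.var 0))))
  /-- `x + 0 = x` -/
  | add_zero : VectorSpaceAxiom (univClosure 1
      ((addT (.var 0) zeroT).equal (.var 0)))
  /-- for every `x` there is `y` with `x + y = 0` -/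
  | exists_neg : VectorSpaceAxiom (univClosure 1
      (Formula.iExs (Fin 1) ((addT (.var (.inl 0)) (.var (.inr 0))).equal zeroT)))
  /-- `λ_q(x + y) = λ_q(x) + λ_q(y)` -/
  | smul_add (q : RatFunc ℚ) : VectorSpaceAxiom (univClosure 2
      ((smulT q (addT (.var 0) (.var 1))).equal (addT (smulT q (.var 0)) (smulT q (.var 1)))))
  /-- `λ_{p + q}(x) = λ_p(x) + λ_q(x)` -/
  | add_smul (p q : RatFunc ℚ) : VectorSpaceAxiom (univClosure 1
      ((smulT (p + q) (.var 0)).equal (addT (smulT p (.var 0)) (smulT q (.var 0)))))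
  /-- `λ_{p q}(x) = λ_p(λ_q(x))` -/
  | mul_smul (p q : RatFunc ℚ) : VectorSpaceAxiom (univClosure 1
      ((smulT (p * q) (.var 0)).equal (smulT p (smulT q (.var 0)))))
  /-- `λ_1(x) = x` -/
  | one_smul : VectorSpaceAxiom (univClosure 1
      ((smulT 1 (.var 0)).equal (.var 0)))

/-- The sentence: for all `a_1 < b_1, …, a_m < b_m` there is `x` such that
`a_i < λ_{q_i}(x) < b_i` for all `i`. In a dense linear order without endpoints it states that
the image of `x ↦ (λ_{q_1}(x), …, λ_{q_m}(x))` is dense in `M ^ m`. -/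
def densitySentence {m : ℕ} (q : Fin m → RatFunc ℚ) : Lt.Sentence :=
  Formula.iAlls (α := Empty) (Fin m ⊕ Fin m)
    ((Formula.iInf fun i : Fin m =>
        ltF (.var (.inr (.inl i))) (.var (.inr (.inr i)))).imp
      (Formula.iExs (Fin 1) (Formula.iInf fun i : Fin m =>
        ltF (.var (.inl (.inr (.inl i)))) (smulT (q i) (.var (.inr 0))) ⊓
        ltF (smulT (q i) (.var (.inr 0))) (.var (.inl (.inr (.inr i)))))))

/-- The theory `T_t`: the theory of `(ℝ, <, +, 0, 1)`, the vector space axioms over `ℚ(t)`, and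
density of the image of `(λ_{q_1}, …, λ_{q_m})` for all `ℚ`-linearly independent
`q_1, …, q_m ∈ ℚ(t)`. -/
def Tt : Lt.Theory :=
  baseTheory ∪ {σ | VectorSpaceAxiom σ} ∪
    {σ | ∃ (m : ℕ) (q : Fin m → RatFunc ℚ), LinearIndependent ℚ q ∧ σ = densitySentence q}

/-! ### The structure on the real numbers -/

/-- The choices made in the construction of the `ℚ(t)`-vector space structure on `ℝ`. The index
set `2 ^ ℵ₀` is the set of functions `ℕ → Bool`. -/
structure Choices where
  /-- a dense basis of `ℝ` over `ℚ` -/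
  B : Set ℝ
  B_dense : Dense B
  B_indep : LinearIndependent ℚ (Subtype.val : B → ℝ)
  B_span : ⊤ ≤ Submodule.span ℚ (Set.range (Subtype.val : B → ℝ))
  /-- a basis of `ℚ(t)` over `ℚ` containing `1` -/
  I : Set (RatFunc ℚ)
  one_mem_I : (1 : RatFunc ℚ) ∈ I
  I_indep : LinearIndependent ℚ (Subtype.val : I → RatFunc ℚ)
  I_span : ⊤ ≤ Submodule.span ℚ (Set.range (Subtype.val : I → RatFunc ℚ))
  /-- the functions `I → B` -/
  f : (ℕ → Bool) → I → B
  f_cover : (⋃ γ, Set.range (f γ)) = Set.univ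
  f_injective : ∀ γ, Function.Injective (f γ)
  f_disjoint : ∀ γ η, η ≠ γ → Set.range (f η) ∩ Set.range (f γ) = ∅
  f_dense : ∀ (m : ℕ) (l r : Fin m → ℝ) (p : Fin m → I), (∀ i, l i < r i) →
    Function.Injective p → ∃ γ, ∀ i, (f γ (p i) : ℝ) ∈ Set.Ioo (l i) (r i)

namespace Choices

variable (c : Choices)

/-- `B` as a basis. -/
def basisB : Module.Basis c.B ℚ ℝ := Module.Basis.mk c.B_indep c.B_span

/-- `I` as a basis. -/
def basisI : Module.Basis c.I ℚ (RatFunc ℚ) := Module.Basis.mk c.I_indep c.I_span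

/-- The `ℚ`-linear extension `f_γ : ℚ(t) → ℝ` of the function `I → B` with index `γ`. -/
def fLin (γ : ℕ → Bool) : RatFunc ℚ →ₗ[ℚ] ℝ :=
  c.basisI.constr ℚ fun p => (c.f γ p : ℝ)

/-- The map sending a finitely supported family `(p_γ)` to `∑ f_γ(p_γ)`. -/
def sumMap : ((ℕ → Bool) →₀ RatFunc ℚ) →ₗ[ℚ] ℝ :=
  Finsupp.lsum ℚ c.fLin

/-- Every real number is `∑ f_γ(p_γ)` for a unique finitely supported family `(p_γ)`. -/
theorem sumMap_bijective : Function.Bijective c.sumMap := by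
  have hbij : Function.Bijective (fun x : (Σ _ : (ℕ → Bool), c.I) => c.f x.1 x.2) := by
    constructor
    · rintro ⟨γ, p⟩ ⟨η, q⟩ h
      by_cases hγ : γ = η
      · subst hγ
        have : p = q := c.f_injective γ h
        rw [this]
      · exfalso
        have h1 : c.f γ p ∈ Set.range (c.f γ) ∩ Set.range (c.f η) :=
          ⟨⟨p, rfl⟩, ⟨q, h.symm⟩⟩
        rw [c.f_disjoint η γ hγ] at h1
        exact h1
    · intro b
      have hb : b ∈ ⋃ γ, Set.range (c.f γ) := by rw [c.f_cover]; trivial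
      obtain ⟨γ, p, hp⟩ := Set.mem_iUnion.1 hb
      exact ⟨⟨γ, p⟩, hp⟩
  let b₁ := Finsupp.basis (fun _ : (ℕ → Bool) => c.basisI)
  let e := b₁.equiv c.basisB (Equiv.ofBijective _ hbij)
  have he : c.sumMap = e.toLinearMap := by
    refine b₁.ext ?_
    rintro ⟨γ, p⟩
    have h1 : e (b₁ ⟨γ, p⟩) = c.basisB (c.f γ p) := by
      simp [e, Module.Basis.equiv_apply]
    rw [LinearEquiv.coe_coe, h1]
    simp [b₁, sumMap, fLin, basisB]
  rw [he]
  exact e.bijective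

/-- The decomposition `a = ∑ f_γ(p_γ)` of real numbers as a linear equivalence. -/
def sumEquiv : ((ℕ → Bool) →₀ RatFunc ℚ) ≃ₗ[ℚ] ℝ :=
  LinearEquiv.ofBijective c.sumMap c.sumMap_bijective

/-- The scalar multiplication: `λ_q(∑ f_γ(p_γ)) = ∑ f_γ(q p_γ)`. -/
def lam (q : RatFunc ℚ) (a : ℝ) : ℝ := c.sumMap (q • c.sumEquiv.symm a)

/-- The structure `(ℝ, (λ_q)_{q ∈ ℚ(t)})`. -/
@[reducible]
def scalarStructure : LScalar.Structure ℝ where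
  funMap
    | ScalarFunc.smul q, x => c.lam q (x 0)
  RelMap r _ := r.elim

/-- The structure `R_t = (ℝ, <, +, 0, 1, (λ_q)_{q ∈ ℚ(t)})`. -/
@[reducible]
def Rt : Lt.Structure ℝ :=
  @FirstOrder.Language.sumStructure LGroup LScalar ℝ realGroupStructure c.scalarStructure

end Choices

end DenseGraph

end

noncomputable section

namespace DenseGraph

/-! ### Linear inequalities over ordered rational vector spaces -/

section OrderedRatModule

variable {V : Type*} [AddCommGroup V] [LinearOrder V] [IsOrderedAddMonoid V] [Module ℚ V]

/-! Everything rests on quantifier elimination: in a model of `Tt` with universe `V`, every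
definable set is a finite union of solution sets of finite systems `0 < t`, `t = 0`, where `t` is
affine over ℚ(t) with constant term a multiple of the element named by `1`. To eliminate `y` from
conditions on `q • y + t(x)`, an equation with `q ≠ 0` is solved for `y`. If only strict
inequalities involve `y`, write their coefficients in a ℚ-linearly independent family `e_1, …, e_m`.
By density, `(e_1 y, …, e_m y)` approximates any point of `V ^ m`, and strict inequalities survive
small perturbations, so the `e_j y` may be replaced by independent variables `y_j`. What remains is
a rational linear system, to which Fourier-Motzkin elimination applies (`IsBasic.proj`).

NIP: an affine condition on `(a, b)` has the form `-g(b) < f(a)`, so it cuts the first `N` of the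
`a_i` in at most `N + 1` ways. Boolean combinations cut them in polynomially many ways, fewer than
`2 ^ N` for large `N`.

EP: the same perturbation argument shows that a definable singleton must come from an equation, so
`dcl` is the ℚ(t)-span of the parameters and the element named by `1`. Exchange is then Steinitz
exchange.

DC holds because ℝ is complete. O-minimality fails because `x ↦ (x, t x)` has dense image in the
plane, so `{x | 0 < t x}` is dense with dense complement. The choices exist because the vectors of a
ℚ-basis of ℝ can be rescaled by rationals into prescribed intervals. -/

theorem posSMulStrictMono_rat : PosSMulStrictMono ℚ V where
  smul_lt_smul_of_pos_left q hq a b hab := by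
    by_contra h
    rw [not_lt] at h
    -- Clearing the denominator leaves a natural multiple, which is monotone in any ordered group.
    have h1 : q.den • q • b ≤ q.den • q • a := nsmul_le_nsmul_right h _
    have h2 : ∀ x : V, q.den • q • x = q.num.toNat • x := fun x => by
      rw [← Nat.cast_smul_eq_nsmul ℚ, ← Nat.cast_smul_eq_nsmul ℚ, smul_smul, mul_comm,
        Rat.mul_den_eq_num]
      congr 1
      have := Int.toNat_of_nonneg (Rat.num_nonneg.2 hq.le)
      exact_mod_cast this.symm
    rw [h2, h2] at h1
    have h3 : q.num.toNat ≠ 0 := by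
      have := Rat.num_pos.2 hq
      omega
    exact absurd (nsmul_lt_nsmul_right h3 hab) (not_lt.2 h1)

theorem denselyOrdered_of_rat_module : DenselyOrdered V where
  dense a b hab := by
    have := posSMulStrictMono_rat (V := V)
    have key : ∀ x : V, (2⁻¹ : ℚ) • (x + x) = x := fun x => by
      rw [← two_smul ℚ, smul_smul]; norm_num
    refine ⟨(2⁻¹ : ℚ) • (a + b), ?_, ?_⟩
    · conv_lhs => rw [← key a]
      exact smul_lt_smul_of_pos_left (by simpa using hab) (by norm_num)
    · conv_rhs => rw [← key b]
      exact smul_lt_smul_of_pos_left (by simpa using hab) (by norm_num)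

/-- Rows with positive coefficient bound `y` from below, those with negative coefficient from above.
Since `V` is dense without endpoints, a solution exists once every lower bound lies below every
upper bound; the condition on pairs is this comparison with denominators cleared. -/
theorem exists_forall_pos_iff [Nontrivial V] (A : List (ℚ × V)) :
    (∃ y, ∀ a ∈ A, 0 < a.1 • y + a.2) ↔
      (∀ a ∈ A, a.1 = 0 → 0 < a.2) ∧
      ∀ a ∈ A, ∀ b ∈ A, 0 < a.1 → b.1 < 0 → 0 < a.1 • b.2 - b.1 • a.2 := by
  classical
  have := posSMulStrictMono_rat (V := V)
  have := denselyOrdered_of_rat_module (V := V)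
  constructor
  · rintro ⟨y, hy⟩
    refine ⟨fun a ha h0 => by simpa [h0] using hy a ha, fun a ha b hb hpos hneg => ?_⟩
    have h1 := smul_pos hpos (hy b hb)
    have h2 := smul_pos (neg_pos.2 hneg) (hy a ha)
    have h3 := add_pos h1 h2
    convert h3 using 1
    module
  · rintro ⟨h0, h⟩
    obtain ⟨y, hlo, hhi⟩ := Order.exists_between_finsets
      ((A.filter fun a => 0 < a.1).map fun a => -(a.1⁻¹ • a.2)).toFinset
      ((A.filter fun a => a.1 < 0).map fun a => -(a.1⁻¹ • a.2)).toFinset (by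
        simp only [List.mem_toFinset, List.mem_map, List.mem_filter, decide_eq_true_eq]
        rintro _ ⟨a, ⟨ha, hpos⟩, rfl⟩ _ ⟨b, ⟨hb, hneg⟩, rfl⟩
        have h1 := h a ha b hb hpos hneg
        have h2 := smul_pos (mul_pos (inv_pos.2 hpos) (neg_pos.2 (inv_lt_zero.2 hneg))) h1
        rw [← sub_pos]
        convert h2 using 1
        have := hneg.ne
        have := hpos.ne'
        match_scalars <;> field_simp)
    simp only [List.mem_toFinset, List.mem_map, List.mem_filter, decide_eq_true_eq,
      forall_exists_index, and_imp] at hlo hhi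
    refine ⟨y, fun a ha => ?_⟩
    rcases lt_trichotomy a.1 0 with hneg | hz | hpos
    · have h1 := smul_pos (neg_pos.2 hneg) (sub_pos.2 (hhi _ a ha hneg rfl))
      have := hneg.ne
      convert h1 using 1
      match_scalars <;> field_simp
    · simpa [hz] using h0 a ha hz
    · have h1 := smul_pos hpos (sub_pos.2 (hlo _ a ha hpos rfl))
      convert h1 using 1
      match_scalars <;> field_simp

/-- Fourier-Motzkin elimination. -/
theorem exists_list_forall_pos_iff [Nontrivial V] {X : Type*} (W : Submodule ℚ (X → V)) (m : ℕ)
    (A : List ((Fin m → ℚ) × W)) :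
    ∃ B : List W, ∀ x, (∃ y : Fin m → V, ∀ a ∈ A, 0 < ∑ j, a.1 j • y j + a.2.1 x) ↔
      ∀ t ∈ B, 0 < t.1 x := by
  induction m with
  | zero =>
    refine ⟨A.map Prod.snd, fun x => ?_⟩
    constructor
    · rintro ⟨y, hy⟩ t ht
      obtain ⟨a, ha, rfl⟩ := List.mem_map.1 ht
      simpa using hy a ha
    · intro h
      exact ⟨0, fun a ha => by simpa using h a.2 (List.mem_map.2 ⟨a, ha, rfl⟩)⟩
  | succ m ih =>
    -- Rows free of the first variable are kept; each pair of rows with opposite signs contributes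
    -- the positive combination that cancels it.
    obtain ⟨B, hB⟩ := ih
      ((A.filter fun a => a.1 0 = 0).map (fun a => (Fin.tail a.1, a.2)) ++
        (A.filter fun a => 0 < a.1 0).flatMap fun a => (A.filter fun b => b.1 0 < 0).map fun b =>
          (a.1 0 • Fin.tail b.1 - b.1 0 • Fin.tail a.1, a.1 0 • b.2 - b.1 0 • a.2))
    refine ⟨B, fun x => ?_⟩
    rw [← hB]
    rw [← (Fin.consEquiv fun _ => V).exists_congr_right, Prod.exists, exists_comm]
    refine exists_congr fun y => ?_
    have h1 := exists_forall_pos_iff (A.map fun a => (a.1 0, ∑ j, a.1 (Fin.succ j) • y j + a.2.1 x))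
    simp only [List.forall_mem_map] at h1
    simp only [Fin.consEquiv_apply, Fin.sum_univ_succ, Fin.cons_zero, Fin.cons_succ, add_assoc]
    rw [h1]
    simp only [List.mem_append, or_imp, forall_and, List.mem_flatMap, List.mem_map, List.mem_filter,
      decide_eq_true_eq]
    refine and_congr ?_ ?_
    · constructor
      · rintro h _ ⟨a, ⟨ha, h0⟩, rfl⟩
        exact h a ha h0
      · intro h a ha h0
        exact h _ ⟨a, ⟨ha, h0⟩, rfl⟩
    · have key : ∀ a b : (Fin (m + 1) → ℚ) × W,
          ∑ j, (a.1 0 • Fin.tail b.1 - b.1 0 • Fin.tail a.1) j • y j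
            + (a.1 0 • b.2 - b.1 0 • a.2).1 x =
          a.1 0 • (∑ j, b.1 (Fin.succ j) • y j + b.2.1 x)
            - b.1 0 • (∑ j, a.1 (Fin.succ j) • y j + a.2.1 x) := fun a b => by
        simp only [Pi.sub_apply, Pi.smul_apply, sub_smul, smul_assoc, Finset.sum_sub_distrib,
          ← Finset.smul_sum, smul_add, Fin.tail, Submodule.coe_sub, Submodule.coe_smul]
        abel
      constructor
      · rintro h _ ⟨a, ⟨ha, hpos⟩, b, ⟨hb, hneg⟩, rfl⟩
        rw [key]
        exact h a ha b hb hpos hneg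
      · intro h a ha b hb hpos hneg
        have := h _ ⟨a, ⟨ha, hpos⟩, b, ⟨hb, hneg⟩, rfl⟩
        rwa [key] at this

end OrderedRatModule

/-- A basis of the ℚ-span of `Q` serves as `e`. This turns coefficients in `K` into rational ones on
several variables `e_j y`. -/
theorem exists_linearIndependent_sum_eq {K : Type*} [Field K] [Algebra ℚ K] (Q : List K) :
    ∃ (m : ℕ) (e : Fin m → K) (r : K → Fin m → ℚ), LinearIndependent ℚ e ∧
      ∀ q ∈ Q, q = ∑ j, r q j • e j := by
  classical
  let s : Submodule ℚ K := Submodule.span ℚ (Q.toFinset : Set K)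
  let b := Module.finBasis ℚ s
  refine ⟨_, fun j => (b j : K), fun q j => if h : q ∈ s then b.repr ⟨q, h⟩ j else 0,
    b.linearIndependent.map' s.subtype s.ker_subtype, fun q hq => ?_⟩
  have h : q ∈ s := Submodule.subset_span (by simpa using hq)
  have h1 := congrArg s.subtype (b.sum_repr ⟨q, h⟩)
  rw [map_sum] at h1
  simp only [h, dite_true]
  exact h1.symm

theorem sum_smul_smul {K V : Type*} [Field K] [Algebra ℚ K] [AddCommGroup V]
    [Module K V] [Module ℚ V] [IsScalarTower ℚ K V] {m : ℕ} (r : Fin m → ℚ) (e : Fin m → K) (x : V) :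
    (∑ j, r j • e j) • x = ∑ j, r j • e j • x := by
  simp [Finset.sum_smul]

/-! ### Semilinear sets -/

section Semilinear

variable {K V X Y : Type*} [Field K] [AddCommGroup V] [LinearOrder V] [Module K V]

/-- The solution sets of finite systems of conditions `0 < t` and `t = 0` with `t ∈ W`. -/
def IsBasic (W : Submodule K (X → V)) (S : Set X) : Prop :=
  ∃ F G : List W, S = {x | (∀ t ∈ F, 0 < t.1 x) ∧ ∀ t ∈ G, t.1 x = 0}

/-- The finite unions of solution sets of finite systems of conditions `0 < t` and `t = 0` with
`t ∈ W`. -/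
def IsSemilinear (W : Submodule K (X → V)) (S : Set X) : Prop :=
  ∃ C : List (Set X), (∀ B ∈ C, IsBasic W B) ∧ S = {x | ∃ B ∈ C, x ∈ B}

variable {W : Submodule K (X → V)} {S T : Set X}

theorem IsBasic.isSemilinear (h : IsBasic W S) : IsSemilinear W S :=
  ⟨[S], by simpa using h, by simp⟩

theorem IsBasic.inter (hS : IsBasic W S) (hT : IsBasic W T) : IsBasic W (S ∩ T) := by
  obtain ⟨F, G, rfl⟩ := hS
  obtain ⟨F', G', rfl⟩ := hT
  refine ⟨F ++ F', G ++ G', ?_⟩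
  ext x
  simp only [List.mem_append, or_imp, forall_and, Set.mem_inter_iff, Set.mem_ofPred_eq]
  tauto

theorem IsSemilinear.empty : IsSemilinear W (∅ : Set X) := ⟨[], by simp, by simp⟩

theorem IsSemilinear.univ : IsSemilinear W (Set.univ : Set X) :=
  IsBasic.isSemilinear ⟨[], [], by simp⟩

theorem IsSemilinear.union (hS : IsSemilinear W S) (hT : IsSemilinear W T) :
    IsSemilinear W (S ∪ T) := by
  obtain ⟨C, hC, rfl⟩ := hS
  obtain ⟨D, hD, rfl⟩ := hT
  refine ⟨C ++ D, fun B hB => (List.mem_append.1 hB).elim (hC B) (hD B), ?_⟩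
  ext x
  simp only [List.mem_append, Set.mem_union, Set.mem_ofPred_eq, or_and_right, exists_or]

theorem IsSemilinear.inter (hS : IsSemilinear W S) (hT : IsSemilinear W T) :
    IsSemilinear W (S ∩ T) := by
  obtain ⟨C, hC, rfl⟩ := hS
  obtain ⟨D, hD, rfl⟩ := hT
  refine ⟨C.flatMap fun A => D.map fun B => A ∩ B, ?_, ?_⟩
  · simp only [List.mem_flatMap, List.mem_map]
    rintro _ ⟨A, hA, B, hB, rfl⟩
    exact (hC A hA).inter (hD B hB)
  · ext x
    simp only [List.mem_flatMap, List.mem_map, Set.mem_inter_iff, Set.mem_ofPred_eq]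
    constructor
    · rintro ⟨⟨A, hA, hx⟩, B, hB, hx'⟩
      exact ⟨_, ⟨A, hA, B, hB, rfl⟩, hx, hx'⟩
    · rintro ⟨_, ⟨A, hA, B, hB, rfl⟩, hx, hx'⟩
      exact ⟨⟨A, hA, hx⟩, B, hB, hx'⟩

theorem IsSemilinear.pos {t : X → V} (ht : t ∈ W) : IsSemilinear W {x | 0 < t x} :=
  IsBasic.isSemilinear ⟨[⟨t, ht⟩], [], by simp⟩

theorem IsSemilinear.zero {t : X → V} (ht : t ∈ W) : IsSemilinear W {x | t x = 0} :=
  IsBasic.isSemilinear ⟨[], [⟨t, ht⟩], by simp⟩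

theorem IsSemilinear.preimage {W' : Submodule K (Y → V)} (h : IsSemilinear W S) (f : Y → X)
    (hf : ∀ t ∈ W, t ∘ f ∈ W') : IsSemilinear W' (f ⁻¹' S) := by
  obtain ⟨C, hC, rfl⟩ := h
  refine ⟨C.map fun B => f ⁻¹' B, ?_, ?_⟩
  · simp only [List.forall_mem_map]
    intro B hB
    obtain ⟨F, G, rfl⟩ := hC B hB
    refine ⟨F.map fun t => ⟨_, hf t.1 t.2⟩, G.map fun t => ⟨_, hf t.1 t.2⟩, ?_⟩
    ext x
    simp only [List.forall_mem_map, Set.mem_preimage, Set.mem_ofPred_eq, Function.comp_apply]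
  · ext x
    simp

section Compl

variable [IsOrderedAddMonoid V]

theorem IsBasic.compl (h : IsBasic W S) : IsSemilinear W Sᶜ := by
  obtain ⟨F, G, rfl⟩ := h
  have hF : IsSemilinear W {x | ∀ t ∈ F, 0 < t.1 x}ᶜ := by
    induction F with
    | nil => simpa using IsSemilinear.empty
    | cons t F ih =>
      convert ((IsSemilinear.pos (W.neg_mem t.2)).union (IsSemilinear.zero t.2)).union ih using 1
      ext x
      simp only [List.forall_mem_cons, Set.mem_compl_iff, Set.mem_union, Set.mem_ofPred_eq, not_and_or,
        not_lt, le_iff_lt_or_eq, Pi.neg_apply, Left.neg_pos_iff]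
  have hG : IsSemilinear W {x | ∀ t ∈ G, t.1 x = 0}ᶜ := by
    clear hF
    induction G with
    | nil => simpa using IsSemilinear.empty
    | cons t G ih =>
      convert ((IsSemilinear.pos (W.neg_mem t.2)).union (IsSemilinear.pos t.2)).union ih using 1
      ext x
      simp only [List.forall_mem_cons, Set.mem_compl_iff, Set.mem_union, Set.mem_ofPred_eq, not_and_or,
        Pi.neg_apply, Left.neg_pos_iff]
      rw [← ne_eq (t.1 x), ne_iff_lt_or_gt]
  convert hF.union hG using 1
  ext x
  simp only [Set.mem_compl_iff, Set.mem_union, Set.mem_ofPred_eq, not_and_or]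

theorem IsSemilinear.compl (h : IsSemilinear W S) : IsSemilinear W Sᶜ := by
  obtain ⟨C, hC, rfl⟩ := h
  induction C with
  | nil => simpa using IsSemilinear.univ
  | cons B C ih =>
    rw [List.forall_mem_cons] at hC
    convert hC.1.compl.inter (ih hC.2) using 1
    ext x
    simp

end Compl

/-- The functions `(x, y) ↦ q y + t(x)` with `t ∈ W`. -/
def extendVar (W : Submodule K (X → V)) : Submodule K (X × V → V) where
  carrier := Set.range fun p : K × W => fun z => p.1 • z.2 + p.2.1 z.1
  add_mem' := by
    rintro _ _ ⟨p, rfl⟩ ⟨p', rfl⟩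
    refine ⟨p + p', ?_⟩
    funext z
    simp only [Prod.fst_add, Prod.snd_add, Submodule.coe_add, Pi.add_apply, add_smul]
    abel
  zero_mem' := ⟨0, by funext z; simp⟩
  smul_mem' := by
    rintro a _ ⟨p, rfl⟩
    refine ⟨a • p, ?_⟩
    funext z
    simp [mul_smul]

/-- The function `(x, y) ↦ q y + t(x)`. -/
def toExtendVar {K V X : Type*} [Field K] [AddCommGroup V] [Module K V] {W : Submodule K (X → V)}
    (p : K × W) : extendVar W := ⟨_, ⟨p, rfl⟩⟩

theorem exists_map_toExtendVar {K V X : Type*} [Field K] [AddCommGroup V] [Module K V]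
    {W : Submodule K (X → V)} (A : List (extendVar W)) :
    ∃ B : List (K × W), B.map toExtendVar = A := by
  have : A ∈ Set.range (List.map (toExtendVar (W := W))) := by
    rw [Set.range_list_map]
    rintro ⟨_, p, rfl⟩ -
    exact ⟨p, rfl⟩
  exact this

/-- The image of `x ↦ (q_1 x, …, q_m x)` is dense in `V ^ m` for all `ℚ`-linearly independent
`q_1, …, q_m`. -/
def DenseScalars (K V : Type*) [Field K] [Algebra ℚ K] [AddCommGroup V] [LinearOrder V]
    [Module K V] : Prop :=
  ∀ (m : ℕ) (q : Fin m → K), LinearIndependent ℚ q → ∀ a b : Fin m → V, (∀ i, a i < b i) →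
    ∃ x : V, ∀ i, a i < q i • x ∧ q i • x < b i

/-! ### Elimination of a variable, and singleton fibres -/

variable [IsOrderedAddMonoid V] [Algebra ℚ K] [Module ℚ V] [IsScalarTower ℚ K V] [Nontrivial V]

/-- Finitely many strict inequalities at `y` leave a common margin. Density puts all `e j • x` so
close to `y j` that no left-hand side changes by as much as this margin. -/
theorem DenseScalars.exists_forall_pos (hd : DenseScalars K V) {m : ℕ} {e : Fin m → K}
    (he : LinearIndependent ℚ e) (A : List ((Fin m → ℚ) × V)) (y : Fin m → V)
    (hy : ∀ a ∈ A, 0 < ∑ j, a.1 j • y j + a.2) :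
    ∃ x : V, ∀ a ∈ A, 0 < (∑ j, a.1 j • e j) • x + a.2 := by
  have := posSMulStrictMono_rat (V := V)
  -- The common margin `d`; a positive `z` serves for the empty list.
  obtain ⟨d, hd0, hdA⟩ : ∃ d : V, 0 < d ∧ ∀ a ∈ A, d ≤ ∑ j, a.1 j • y j + a.2 := by
    obtain ⟨z, hz⟩ := exists_gt (0 : V)
    clear hd
    induction A with
    | nil => exact ⟨z, hz, by simp⟩
    | cons a A ih =>
      rw [List.forall_mem_cons] at hy
      obtain ⟨d, hd0, hd⟩ := ih hy.2
      refine ⟨min d (∑ j, a.1 j • y j + a.2), lt_min hd0 hy.1, ?_⟩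
      rw [List.forall_mem_cons]
      exact ⟨min_le_right _ _, fun b hb => (min_le_left _ _).trans (hd b hb)⟩
  -- `N` exceeds the sum of absolute coefficients of every row, so moving each variable by at most
  -- `N⁻¹ • d` changes a row by less than `d`.
  obtain ⟨N, hN0, hN⟩ : ∃ N : ℚ, 0 < N ∧ ∀ a ∈ A, ∑ j, |a.1 j| < N := by
    clear hy hdA
    induction A with
    | nil => exact ⟨1, one_pos, by simp⟩
    | cons a A ih =>
      obtain ⟨N, hN0, hN⟩ := ih
      refine ⟨max N (∑ j, |a.1 j| + 1), lt_max_of_lt_left hN0, ?_⟩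
      rw [List.forall_mem_cons]
      exact ⟨lt_max_of_lt_right (lt_add_one _), fun b hb => lt_max_of_lt_left (hN b hb)⟩
  have hδ : 0 < N⁻¹ • d := smul_pos (inv_pos.2 hN0) hd0
  obtain ⟨x, hx⟩ := hd m e he (fun j => y j - N⁻¹ • d) (fun j => y j + N⁻¹ • d)
    (fun j => (sub_lt_self _ hδ).trans (lt_add_of_pos_right _ hδ))
  refine ⟨x, fun a ha => ?_⟩
  rw [sum_smul_smul]
  have h1 : ∀ j, -(|a.1 j| • N⁻¹ • d) ≤ a.1 j • (e j • x - y j) := fun j => by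
    refine le_trans (neg_le_neg ?_) (neg_abs_le _)
    rw [abs_smul]
    refine smul_le_smul_of_nonneg_left ?_ (abs_nonneg _)
    rw [abs_le]
    exact ⟨by rw [neg_le_sub_iff_le_add, ← sub_le_iff_le_add]; exact (hx j).1.le,
      by rw [sub_le_iff_le_add, add_comm]; exact (hx j).2.le⟩
  have h2 := Finset.sum_le_sum fun j (_ : j ∈ Finset.univ) => h1 j
  rw [Finset.sum_neg_distrib, ← Finset.sum_smul, smul_smul] at h2
  simp only [smul_sub, Finset.sum_sub_distrib] at h2
  have h3 : ((∑ j, |a.1 j|) * N⁻¹) • d < d := by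
    have hlt : 0 < 1 - (∑ j, |a.1 j|) * N⁻¹ := by
      rw [sub_pos, ← div_eq_mul_inv, div_lt_one hN0]
      exact hN a ha
    have := smul_pos hlt hd0
    rwa [sub_smul, one_smul, sub_pos] at this
  have h4 := hdA a ha
  calc (0 : V) < d + -(((∑ j, |a.1 j|) * N⁻¹) • d) := by rwa [← sub_eq_add_neg, sub_pos]
    _ ≤ (∑ j, a.1 j • y j + a.2) + (∑ j, a.1 j • e j • x - ∑ j, a.1 j • y j) := add_le_add h4 h2
    _ = _ := by abel

/-- Either some equation involves `y` and determines it, so that substitution works, or the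
equations constrain only `x`. In the second case density trades the multiples of `y` for independent
variables, which Fourier-Motzkin elimination removes. -/
theorem IsBasic.proj (hd : DenseScalars K V) {S : Set (X × V)} (h : IsBasic (extendVar W) S) :
    IsSemilinear W {x | ∃ y, (x, y) ∈ S} := by
  have hS := h.isSemilinear
  obtain ⟨F, G, rfl⟩ := h
  by_cases hG : ∃ u ∈ G, ∃ (q : K) (t : W), q ≠ 0 ∧ u.1 = fun z => q • z.2 + t.1 z.1
  · obtain ⟨u, hu, q, t, hq, hut⟩ := hG
    convert hS.preimage (W' := W) (fun x => (x, -(q⁻¹ • t.1 x))) ?_ using 1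
    · ext x
      constructor
      · rintro ⟨y, hy⟩
        have h1 := hy.2 u hu
        rw [hut] at h1
        have h2 : y = -(q⁻¹ • t.1 x) := by
          rw [← smul_neg, ← eq_neg_of_add_eq_zero_left h1, smul_smul, inv_mul_cancel₀ hq, one_smul]
        rwa [h2] at hy
      · exact fun hx => ⟨_, hx⟩
    · rintro _ ⟨p, rfl⟩
      exact W.add_mem (W.smul_mem p.1 (W.neg_mem (W.smul_mem _ t.2))) p.2.2
  · push Not at hG
    obtain ⟨F, rfl⟩ := exists_map_toExtendVar F
    obtain ⟨G, rfl⟩ := exists_map_toExtendVar G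
    have hG0 : ∀ p ∈ G, p.1 = 0 := fun p hp => by
      by_contra h
      exact hG (toExtendVar p) (List.mem_map.2 ⟨p, hp, rfl⟩) p.1 p.2 h rfl
    obtain ⟨m, e, r, he, hr⟩ := exists_linearIndependent_sum_eq (F.map Prod.fst)
    simp only [List.forall_mem_map] at hr
    obtain ⟨B, hB⟩ := exists_list_forall_pos_iff (W.restrictScalars ℚ) m
      (F.map fun p => (r p.1, p.2))
    simp only [List.forall_mem_map] at hB
    refine IsBasic.isSemilinear ⟨B, G.map Prod.snd, ?_⟩
    ext x
    simp only [Set.mem_ofPred_eq, List.forall_mem_map, toExtendVar]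
    have hG1 : ∀ y, (∀ p ∈ G, p.1 • y + p.2.1 x = 0) ↔ ∀ p ∈ G, p.2.1 x = 0 := fun y =>
      forall₂_congr fun p hp => by rw [hG0 p hp, zero_smul, zero_add]
    simp only [hG1, exists_and_right]
    refine and_congr_left fun _ => Iff.trans ?_ (hB x)
    -- A genuine `y` gives `y_j = e_j y`; conversely a solution in independent variables is
    -- approximated by the multiples of a single element.
    constructor
    · rintro ⟨y, hy⟩
      refine ⟨fun j => e j • y, fun p hp => ?_⟩
      have := hy p hp
      rwa [hr p hp, sum_smul_smul] at this
    · rintro ⟨y, hy⟩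
      obtain ⟨z, hz⟩ := hd.exists_forall_pos he (F.map fun p => (r p.1, p.2.1 x)) y
        (by simpa only [List.forall_mem_map] using hy)
      simp only [List.forall_mem_map] at hz
      exact ⟨z, fun p hp => by rw [hr p hp]; exact hz p hp⟩

theorem IsSemilinear.proj (hd : DenseScalars K V) {S : Set (X × V)}
    (h : IsSemilinear (extendVar W) S) : IsSemilinear W {x | ∃ y, (x, y) ∈ S} := by
  obtain ⟨C, hC, rfl⟩ := h
  induction C with
  | nil => simpa using IsSemilinear.empty
  | cons B C ih =>
    rw [List.forall_mem_cons] at hC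
    convert (hC.1.proj hd).union (ih hC.2) using 1
    ext x
    simp [exists_or]

/-- The basic piece containing `(x, b)` must have an equation with nonzero `y`-coefficient, and
solving it gives `t`. Otherwise only strict inequalities restrict `y`, and the fibre would contain a
point above `b`. -/
theorem IsSemilinear.exists_eq_of_fiber (hd : DenseScalars K V) {S : Set (X × V)}
    (h : IsSemilinear (extendVar W) S) {x : X} {b : V} (hb : ∀ y, (x, y) ∈ S ↔ y = b) :
    ∃ t ∈ W, t x = b := by
  have := posSMulStrictMono_rat (V := V)
  obtain ⟨C, hC, rfl⟩ := h
  obtain ⟨B, hB, hxb⟩ := (hb b).2 rfl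
  replace hb : ∀ y, (x, y) ∈ B → y = b := fun y hy => (hb y).1 ⟨B, hB, hy⟩
  obtain ⟨F, G, rfl⟩ := hC B hB
  obtain ⟨F, rfl⟩ := exists_map_toExtendVar F
  obtain ⟨G, rfl⟩ := exists_map_toExtendVar G
  simp only [Set.mem_ofPred_eq, List.forall_mem_map, toExtendVar] at hxb hb
  by_cases hG : ∃ p ∈ G, p.1 ≠ 0
  · obtain ⟨p, hp, hp0⟩ := hG
    refine ⟨-(p.1⁻¹ • p.2.1), W.neg_mem (W.smul_mem _ p.2.2), ?_⟩
    rw [Pi.neg_apply, Pi.smul_apply, ← smul_neg, ← eq_neg_of_add_eq_zero_left (hxb.2 p hp),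
      smul_smul, inv_mul_cancel₀ hp0, one_smul]
  · push Not at hG
    exfalso
    -- Including `1` makes `0 < z - b` one more inequality of the system.
    obtain ⟨m, e, r, he, hr⟩ := exists_linearIndependent_sum_eq (1 :: F.map Prod.fst)
    rw [List.forall_mem_cons] at hr
    obtain ⟨hr1, hr⟩ := hr
    simp only [List.forall_mem_map] at hr
    have hF : ∀ p ∈ F, 0 < p.1 • b + p.2.1 x := hxb.1
    -- The point `(e_j b)_j` will be moved by `ε` in the direction `r 1`. This `ε > 0` is small
    -- enough to preserve all inequalities of `F`.
    obtain ⟨ε, hε⟩ := (exists_forall_pos_iff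
      ((1, (0 : V)) :: F.map fun p => (∑ j, r p.1 j * r 1 j, p.1 • b + p.2.1 x))).2 (by
        simp only [List.forall_mem_cons, List.forall_mem_map]
        refine ⟨⟨by simp, fun p hp _ => hF p hp⟩,
          ⟨by simp, fun p hp _ _ => by simpa using hF p hp⟩,
          fun p hp => ⟨fun _ h => absurd h (by norm_num), fun p' hp' h h' => ?_⟩⟩
        rw [sub_eq_add_neg, ← neg_smul]
        exact add_pos (smul_pos h (hF p' hp')) (smul_pos (neg_pos.2 h') (hF p hp)))
    simp only [List.forall_mem_cons, List.forall_mem_map, one_smul, add_zero] at hε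
    have key : ∀ q : Fin m → ℚ, ∑ j, q j • (e j • b + r 1 j • ε) =
        (∑ j, q j • e j) • b + (∑ j, q j * r 1 j) • ε := fun q => by
      rw [sum_smul_smul, Finset.sum_smul, ← Finset.sum_add_distrib]
      exact Finset.sum_congr rfl fun j _ => by rw [smul_add, smul_smul]
    -- The form expressing `1 • y` grows along its own coefficient vector, so the move makes its
    -- value exceed `b`.
    have hpos : 0 < ∑ j, r 1 j * r 1 j := by
      refine lt_of_le_of_ne (Finset.sum_nonneg fun j _ => mul_self_nonneg _) fun h0 => ?_
      rw [eq_comm, Finset.sum_eq_zero_iff_of_nonneg fun j _ => mul_self_nonneg _] at h0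
      refine one_ne_zero (α := K) ?_
      rw [hr1]
      exact Finset.sum_eq_zero fun j hj => by rw [mul_self_eq_zero.1 (h0 j hj), zero_smul]
    obtain ⟨z, hz⟩ := hd.exists_forall_pos he ((r 1, -b) :: F.map fun p => (r p.1, p.2.1 x))
      (fun j => e j • b + r 1 j • ε) (by
        simp only [List.forall_mem_cons, List.forall_mem_map, key]
        refine ⟨?_, fun p hp => ?_⟩
        · rw [← hr1, one_smul, add_neg_cancel_comm]
          exact smul_pos hpos hε.1
        · rw [← hr p hp, add_right_comm, add_comm]
          exact hε.2 p hp)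
    simp only [List.forall_mem_cons, List.forall_mem_map, ← hr1, one_smul] at hz
    have hzb := hb z ⟨fun p hp => by rw [hr p hp]; exact hz.2 p hp, fun p hp => by
      have := hxb.2 p hp
      rwa [hG p hp, zero_smul] at this ⊢⟩
    rw [hzb, add_neg_cancel] at hz
    exact lt_irrefl _ hz.1

end Semilinear

/-! ### Definable sets in dense vector spaces are semilinear -/

/-- The symbol `1`. -/
def oneSymb : Lt.Functions 0 := Sum.inl GroupFunc.one

/-- The symbols of `Lt` are interpreted by the order, the addition, the scalar multiplication, and
the element `e`. -/
structure IsScalarModel {V : Type*} [AddCommGroup V] [LinearOrder V] [Module (RatFunc ℚ) V]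
    [Lt.Structure V] (e : V) : Prop where
  zero : ∀ x, Structure.funMap zeroSymb x = (0 : V)
  one : ∀ x, Structure.funMap oneSymb x = e
  add : ∀ x : Fin 2 → V, Structure.funMap addSymb x = x 0 + x 1
  smul : ∀ q, ∀ x : Fin 1 → V, Structure.funMap (smulSymb q) x = q • x 0
  lt : ∀ x : Fin 2 → V, Structure.RelMap ltSymb x ↔ x 0 < x 1

section

variable {V : Type*} [AddCommGroup V] [Module (RatFunc ℚ) V]

/-- The functions `V ^ ι → V` spanned by the coordinates and the constant `e`. -/
def affine (e : V) (ι : Type*) : Submodule (RatFunc ℚ) ((ι → V) → V) :=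
  Submodule.span _ (insert (fun _ => e) (Set.range fun i v => v i))

theorem const_mem_affine (e : V) (ι : Type*) : (fun _ => e) ∈ affine e ι :=
  Submodule.subset_span (Set.mem_insert _ _)

theorem coord_mem_affine (e : V) {ι : Type*} (i : ι) : (fun v => v i) ∈ affine e ι :=
  Submodule.subset_span (Set.mem_insert_of_mem _ ⟨i, rfl⟩)

theorem comp_mem_of_mem_affine {e : V} {ι Y : Type*} {W : Submodule (RatFunc ℚ) (Y → V)}
    (f : Y → ι → V) (he : (fun _ => e) ∈ W) (hf : ∀ i, (fun y => f y i) ∈ W) :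
    ∀ t ∈ affine e ι, t ∘ f ∈ W := by
  intro t ht
  induction ht using Submodule.span_induction with
  | mem t ht =>
    obtain rfl | ⟨i, rfl⟩ := ht
    · exact he
    · exact hf i
  | zero => exact W.zero_mem
  | add s t _ _ hs ht => exact W.add_mem hs ht
  | smul q t _ ht => exact W.smul_mem q ht

/-- Separating the variables turns `0 < t(a, b)` into a comparison in a linear order, the input for
`fewTraces_lt`. -/
theorem exists_add_of_mem_affine {e : V} {ι κ : Type*} {t : (ι ⊕ κ → V) → V}
    (ht : t ∈ affine e (ι ⊕ κ)) :
    ∃ (f : (ι → V) → V) (g : (κ → V) → V), ∀ a b, t (Sum.elim a b) = f a + g b := by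
  induction ht using Submodule.span_induction with
  | mem t ht =>
    obtain rfl | ⟨i | i, rfl⟩ := ht
    · exact ⟨fun _ => e, fun _ => 0, by simp⟩
    · exact ⟨fun a => a i, fun _ => 0, by simp⟩
    · exact ⟨fun _ => 0, fun b => b i, by simp⟩
  | zero => exact ⟨fun _ => 0, fun _ => 0, by simp⟩
  | add s t _ _ hs ht =>
    obtain ⟨f, g, h⟩ := hs
    obtain ⟨f', g', h'⟩ := ht
    exact ⟨f + f', g + g', fun a b => by
      simp only [Pi.add_apply, h, h']
      abel⟩
  | smul q t _ ht =>
    obtain ⟨f, g, h⟩ := ht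
    exact ⟨q • f, q • g, fun a b => by simp [h]⟩

theorem mem_extendVar {X : Type*} {W : Submodule (RatFunc ℚ) (X → V)} {t : X → V} (ht : t ∈ W) :
    (fun z => t z.1) ∈ extendVar W :=
  ⟨(0, ⟨t, ht⟩), by funext z; simp⟩

theorem snd_mem_extendVar {X : Type*} (W : Submodule (RatFunc ℚ) (X → V)) :
    Prod.snd ∈ extendVar W :=
  ⟨(1, 0), by funext z; simp⟩

end

section

variable {V : Type*} [AddCommGroup V] [LinearOrder V] [Module (RatFunc ℚ) V] [Lt.Structure V]
  {e : V}

theorem IsScalarModel.realize_mem_affine (h : IsScalarModel e) {ι : Type*} (t : Lt.Term ι) :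
    (fun v => t.realize v) ∈ affine e ι := by
  induction t with
  | var i => exact coord_mem_affine e i
  | func f ts ih =>
    rcases f with (_ | _ | _) | q
    · convert (affine e ι).zero_mem using 1
      funext v
      exact h.zero _
    · convert const_mem_affine e ι using 1
      funext v
      exact h.one _
    · convert (affine e ι).add_mem (ih 0) (ih 1) using 1
      funext v
      exact h.add _
    · obtain ⟨q⟩ := q
      convert (affine e ι).smul_mem q (ih 0) using 1
      funext v
      exact h.smul q _

variable [IsOrderedAddMonoid V] [Nontrivial V] [Module ℚ V]

/-- Quantifier elimination by induction on formulas. Density is needed only for the quantifier, read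
as the complement of a projection of a complement. -/
theorem IsScalarModel.isSemilinear_boundedFormula (h : IsScalarModel e)
    (hd : DenseScalars (RatFunc ℚ) V) {α : Type*} {n : ℕ} (φ : Lt.BoundedFormula α n) :
    IsSemilinear (affine e (α ⊕ Fin n)) {v | φ.Realize (v ∘ Sum.inl) (v ∘ Sum.inr)} := by
  induction φ with
  | falsum => exact IsSemilinear.empty
  | equal t₁ t₂ =>
    convert IsSemilinear.zero
      ((affine e _).sub_mem (h.realize_mem_affine t₁) (h.realize_mem_affine t₂)) using 1
    ext v
    simp [BoundedFormula.Realize, Sum.elim_comp_inl_inr, sub_eq_zero]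
  | rel R ts =>
    rcases R with ⟨⟨⟩⟩ | R
    · convert IsSemilinear.pos
        ((affine e _).sub_mem (h.realize_mem_affine (ts 1)) (h.realize_mem_affine (ts 0))) using 1
      ext v
      simp only [BoundedFormula.Realize, Sum.elim_comp_inl_inr, Set.mem_ofPred_eq, Pi.sub_apply,
        sub_pos]
      exact h.lt _
    · exact R.elim
  | imp φ ψ hφ hψ =>
    convert hφ.compl.union hψ using 1
    ext v
    simp [imp_iff_not_or]
  | @all n φ ih =>
    -- The quantified variable, last in the tuple, becomes the second component of a pair so that
    -- `proj` applies.
    have h1 := ih.compl.preimage (W' := extendVar (affine e (α ⊕ Fin n)))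
      (fun z => Sum.elim (z.1 ∘ Sum.inl) (Fin.snoc (z.1 ∘ Sum.inr) z.2 : Fin (n + 1) → V))
      (comp_mem_of_mem_affine _ (mem_extendVar (const_mem_affine e _)) (by
        rintro (i | i)
        · exact mem_extendVar (coord_mem_affine e (Sum.inl i))
        · refine Fin.lastCases ?_ (fun i => ?_) i
          · simpa using snd_mem_extendVar _
          · simpa using mem_extendVar (coord_mem_affine e (Sum.inr i : α ⊕ Fin n))))
    convert (h1.proj hd).compl using 1
    ext v
    simp

theorem IsScalarModel.isSemilinear_formula (h : IsScalarModel e) (hd : DenseScalars (RatFunc ℚ) V)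
    {α : Type*} (φ : Lt.Formula α) : IsSemilinear (affine e α) {v | φ.Realize v} := by
  refine ((h.isSemilinear_boundedFormula hd φ).preimage (W' := affine e α)
    (fun v => Sum.elim v default) (comp_mem_of_mem_affine _ (const_mem_affine e _) ?_))
  rintro (i | i)
  · exact coord_mem_affine e i
  · exact i.elim0

end

/-! ### NIP -/

/-- The number of traces of the relation `R` on the first `N` natural numbers is bounded by a
power of `N + 1`. -/
def FewTraces {β : Type*} (R : ℕ → β → Prop) : Prop :=
  ∃ k : ℕ, ∀ N : ℕ, ∃ g : β → Fin k → Fin (N + 1),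
    ∀ b b', g b = g b' → ∀ i < N, R i b ↔ R i b'

section FewTraces

variable {β : Type*} {R S : ℕ → β → Prop}

theorem fewTraces_const (p : Prop) : FewTraces fun _ (_ : β) => p :=
  ⟨0, fun _ => ⟨fun _ _ => 0, fun _ _ _ _ _ => Iff.rfl⟩⟩

theorem FewTraces.not (h : FewTraces R) : FewTraces fun i b => ¬ R i b := by
  obtain ⟨k, h⟩ := h
  refine ⟨k, fun N => ?_⟩
  obtain ⟨g, hg⟩ := h N
  exact ⟨g, fun b b' hb i hi => not_congr (hg b b' hb i hi)⟩

theorem FewTraces.and (hR : FewTraces R) (hS : FewTraces S) :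
    FewTraces fun i b => R i b ∧ S i b := by
  obtain ⟨k, hR⟩ := hR
  obtain ⟨l, hS⟩ := hS
  refine ⟨k + l, fun N => ?_⟩
  obtain ⟨f, hf⟩ := hR N
  obtain ⟨g, hg⟩ := hS N
  refine ⟨fun b => Fin.append (f b) (g b), fun b b' hb i hi => ?_⟩
  refine and_congr (hf b b' ?_ i hi) (hg b b' ?_ i hi)
  · funext j
    simpa using congrFun hb (Fin.castAdd l j)
  · funext j
    simpa using congrFun hb (Fin.natAdd k j)

theorem FewTraces.forall_mem {γ : Type*} {R : γ → ℕ → β → Prop} {l : List γ}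
    (h : ∀ c ∈ l, FewTraces (R c)) : FewTraces fun i b => ∀ c ∈ l, R c i b := by
  induction l with
  | nil => simpa using fewTraces_const True
  | cons c l ih =>
    rw [List.forall_mem_cons] at h
    simpa only [List.forall_mem_cons] using h.1.and (ih h.2)

theorem FewTraces.exists_mem {γ : Type*} {R : γ → ℕ → β → Prop} {l : List γ}
    (h : ∀ c ∈ l, FewTraces (R c)) : FewTraces fun i b => ∃ c ∈ l, R c i b := by
  have h1 := (FewTraces.forall_mem (R := fun c i b => ¬ R c i b) fun c hc => (h c hc).not).not
  simpa only [not_forall, not_not, exists_prop] using h1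

/-- The sets `{i < N | w b < u i}` form a chain under inclusion, so each is determined by its
cardinality, a number at most `N`. -/
theorem fewTraces_lt {V : Type*} [LinearOrder V] (u : ℕ → V) (w : β → V) :
    FewTraces fun i b => w b < u i := by
  classical
  refine ⟨1, fun N => ⟨fun b _ => ⟨((Finset.range N).filter fun i => w b < u i).card, ?_⟩, ?_⟩⟩
  · exact Nat.lt_succ_of_le ((Finset.card_filter_le _ _).trans (Finset.card_range N).le)
  · have key : ∀ b b', w b ≤ w b' →
        ((Finset.range N).filter fun i => w b < u i).card =
          ((Finset.range N).filter fun i => w b' < u i).card →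
        ∀ i < N, w b < u i ↔ w b' < u i := fun b b' hle hcard i hi => by
      have hsub : ((Finset.range N).filter fun i => w b' < u i) ⊆
          (Finset.range N).filter fun i => w b < u i :=
        Finset.monotone_filter_right _ fun i _ hi => hle.trans_lt hi
      have := Finset.ext_iff.1 (Finset.eq_of_subset_of_card_le hsub hcard.le) i
      simpa [hi] using this.symm
    intro b b' hb i hi
    have hcard := Fin.mk.inj (congrFun hb 0)
    rcases le_total (w b) (w b') with hle | hle
    · exact key b b' hle hcard i hi
    · exact (key b' b hle hcard.symm i hi).symm

theorem exists_succ_pow_lt_two_pow (k : ℕ) : ∃ N : ℕ, (N + 1) ^ k < 2 ^ N := by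
  have h := (Filter.tendsto_add_atTop_iff_nat 1).2
    (tendsto_pow_const_div_const_pow_of_one_lt k (one_lt_two (α := ℝ)))
  -- The bound `1 / 2` absorbs the extra factor in `2 ^ (N + 1)` caused by the shift.
  obtain ⟨N, hN⟩ := (h.eventually (gt_mem_nhds (by norm_num : (0 : ℝ) < 1 / 2))).exists
  refine ⟨N, ?_⟩
  rw [div_lt_iff₀ (by positivity), pow_succ 2 N] at hN
  have h2 : ((N : ℝ) + 1) ^ k < 2 ^ N := by
    push_cast at hN
    linarith
  exact_mod_cast h2

/-- Shattering would give the `2 ^ N` subsets of the first `N` numbers distinct codes, while only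
`(N + 1) ^ k` codes exist. -/
theorem FewTraces.not_shatters {R : ℕ → Set ℕ → Prop} (h : FewTraces R) :
    ¬ ∀ i J, R i J ↔ i ∈ J := by
  intro hR
  obtain ⟨k, h⟩ := h
  obtain ⟨N, hN⟩ := exists_succ_pow_lt_two_pow k
  obtain ⟨g, hg⟩ := h N
  have hinj : Set.InjOn (fun s : Finset ℕ => g ↑s) ((Finset.range N).powerset : Set (Finset ℕ)) := by
    intro s hs t ht hst
    simp only [Finset.coe_powerset, Set.mem_preimage, Set.mem_powerset_iff, Finset.coe_subset]
      at hs ht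
    have h1 := hg _ _ hst
    ext i
    by_cases hi : i < N
    · simpa only [hR, Finset.mem_coe] using h1 i hi
    · exact ⟨fun h => absurd (Finset.mem_range.1 (hs h)) hi,
        fun h => absurd (Finset.mem_range.1 (ht h)) hi⟩
  have h2 := Finset.card_le_card_of_injOn (t := (Finset.univ : Finset (Fin k → Fin (N + 1)))) _
    (fun _ _ => Finset.mem_univ _) hinj
  simp at h2
  omega

end FewTraces

section

variable {V : Type*} [AddCommGroup V] [LinearOrder V] [IsOrderedAddMonoid V]
  [Module (RatFunc ℚ) V]

theorem IsSemilinear.fewTraces {e : V} {ι κ β : Type*} {S : Set (ι ⊕ κ → V)}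
    (h : IsSemilinear (affine e (ι ⊕ κ)) S) (a : ℕ → ι → V) (b : β → κ → V) :
    FewTraces fun i j => Sum.elim (a i) (b j) ∈ S := by
  have hpos : ∀ t ∈ affine e (ι ⊕ κ), FewTraces fun i j => 0 < t (Sum.elim (a i) (b j)) := by
    intro t ht
    obtain ⟨f, g, hfg⟩ := exists_add_of_mem_affine ht
    simpa only [hfg, neg_lt_iff_pos_add] using
      fewTraces_lt (fun i => f (a i)) (fun j => -g (b j))
  obtain ⟨C, hC, rfl⟩ := h
  refine FewTraces.exists_mem fun B hB => ?_
  obtain ⟨F, G, rfl⟩ := hC B hB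
  refine (FewTraces.forall_mem fun t _ => hpos t.1 t.2).and (FewTraces.forall_mem fun t _ => ?_)
  -- `t = 0` means that neither `t` nor `-t` is positive.
  have h1 := (hpos t.1 t.2).not.and (hpos _ (Submodule.neg_mem _ t.2)).not
  simpa only [not_lt, Pi.neg_apply, Left.neg_nonpos_iff, ← le_antisymm_iff] using h1

end

/-! ### Models of the theory -/

section Realize

variable {M : Type*} [Lt.Structure M] {α : Type} (v : α → M)

@[simp]
theorem realize_addT (s t : Lt.Term α) :
    (addT s t).realize v = Structure.funMap addSymb ![s.realize v, t.realize v] := by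
  simp only [addT, Term.realize_func]
  congr 1
  funext i
  fin_cases i <;> rfl

@[simp]
theorem realize_zeroT : (zeroT : Lt.Term α).realize v = Structure.funMap zeroSymb ![] := by
  simp only [zeroT, Term.realize_func]
  congr 1
  exact Subsingleton.elim _ _

@[simp]
theorem realize_smulT (q : RatFunc ℚ) (s : Lt.Term α) :
    (smulT q s).realize v = Structure.funMap (smulSymb q) ![s.realize v] := by
  simp only [smulT, Term.realize_func]
  congr 1
  funext i
  fin_cases i
  rfl

@[simp]
theorem realize_ltF (s t : Lt.Term α) :
    (ltF s t).Realize v ↔ Structure.RelMap ltSymb ![s.realize v, t.realize v] := by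
  simp only [ltF, Formula.realize_rel]
  refine iff_of_eq ?_
  congr 1
  funext i
  fin_cases i <;> rfl

variable (M) in
theorem realize_univClosure {k : ℕ} (φ : Lt.Formula (Fin k)) :
    M ⊨ univClosure k φ ↔ ∀ v : Fin k → M, φ.Realize v := by
  simp only [univClosure, Sentence.Realize, Formula.realize_iAlls, Formula.realize_relabel]
  rfl

variable (M) in
theorem realize_densitySentence {m : ℕ} (q : Fin m → RatFunc ℚ) :
    M ⊨ densitySentence q ↔ ∀ a b : Fin m → M, (∀ i, Structure.RelMap ltSymb ![a i, b i]) →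
      ∃ x : M, ∀ i, Structure.RelMap ltSymb ![a i, Structure.funMap (smulSymb (q i)) ![x] ] ∧
        Structure.RelMap ltSymb ![Structure.funMap (smulSymb (q i)) ![x], b i] := by
  simp only [densitySentence, Sentence.Realize, Formula.realize_iAlls, Formula.realize_imp,
    Formula.realize_iInf, Formula.realize_iExs, Formula.realize_inf, realize_ltF, realize_smulT,
    Term.realize_var, Sum.elim_inl, Sum.elim_inr]
  constructor
  · intro h a b hab
    obtain ⟨x, hx⟩ := h (Sum.elim a b) hab
    exact ⟨x 0, hx⟩
  · intro h i hi
    obtain ⟨x, hx⟩ := h _ _ hi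
    exact ⟨fun _ => x, hx⟩

end Realize

section Model

variable {M : Type*} [Lt.Structure M]

/-- The universal closure of `φ` lies in the complete theory of ℝ. All order properties of a model
are obtained by this transfer. -/
theorem realize_of_forall_real (hM : M ⊨ baseTheory) {k : ℕ} (φ : LGroup.Formula (Fin k))
    (hφ : ∀ v : Fin k → ℝ, φ.Realize v) (v : Fin k → M) :
    letI := (LHom.sumInl : LGroup →ᴸ Lt).reduct M
    φ.Realize v := by
  let := (LHom.sumInl : LGroup →ᴸ Lt).reduct M
  have h1 : M ⊨ LGroup.completeTheory ℝ := (LHom.onTheory_model _ _).1 hM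
  let σ : LGroup.Sentence := Formula.iAlls (Fin k) (φ.relabel (Sum.inr : Fin k → Empty ⊕ Fin k))
  have hσ : ℝ ⊨ σ := by
    simp only [σ, Sentence.Realize, Formula.realize_iAlls, Formula.realize_relabel]
    exact hφ
  have h2 : M ⊨ σ := h1.realize_of_mem _ hσ
  simp only [σ, Sentence.Realize, Formula.realize_iAlls, Formula.realize_relabel] at h2
  exact h2 v

theorem vec_two_eta {M : Type*} (x : Fin 2 → M) : ![x 0, x 1] = x := by
  funext i
  fin_cases i <;> rfl

theorem vec_one_eta {M : Type*} (x : Fin 1 → M) : ![x 0] = x := by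
  funext i
  fin_cases i
  rfl

/-- The symbol `<` in the language of ordered groups. -/
def groupLtSymb : LGroup.Relations 2 := GroupRel.lt

/-- The symbol `+` in the language of ordered groups. -/
def groupAddSymb : LGroup.Functions 2 := GroupFunc.add

/-- The symbol `0` in the language of ordered groups. -/
def groupZeroSymb : LGroup.Functions 0 := GroupFunc.zero

/-- The symbol `1` in the language of ordered groups. -/
def groupOneSymb : LGroup.Functions 0 := GroupFunc.one

/-- The formula `s < t` in the language of ordered groups. -/
def groupLt {α : Type} (s t : LGroup.Term α) : LGroup.Formula α :=
  groupLtSymb.formula ![s, t]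

theorem realize_groupLt {α : Type} (s t : LGroup.Term α) {M : Type*} [LGroup.Structure M]
    (v : α → M) :
    (groupLt s t).Realize v ↔
      Structure.RelMap groupLtSymb ![s.realize v, t.realize v] := by
  simp only [groupLt, Formula.realize_rel]
  refine iff_of_eq ?_
  congr 1
  funext i
  fin_cases i <;> rfl

/-- The term `s + t` in the language of ordered groups. -/
def groupAdd {α : Type} (s t : LGroup.Term α) : LGroup.Term α :=
  Term.func groupAddSymb ![s, t]

theorem realize_groupAdd {α : Type} (s t : LGroup.Term α) {M : Type*} [LGroup.Structure M]
    (v : α → M) :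
    (groupAdd s t).realize v =
      Structure.funMap groupAddSymb ![s.realize v, t.realize v] := by
  simp only [groupAdd, Term.realize_func]
  congr 1
  funext i
  fin_cases i <;> rfl

theorem real_groupLt (a b : ℝ) :
    Structure.RelMap groupLtSymb ![a, b] ↔ a < b := Iff.rfl

theorem real_groupAdd (a b : ℝ) :
    Structure.funMap groupAddSymb ![a, b] = a + b := rfl

theorem lt_irrefl_of_model (hM : M ⊨ baseTheory) (x : M) : ¬ Structure.RelMap ltSymb ![x, x] := by
  let := (LHom.sumInl : LGroup →ᴸ Lt).reduct M
  have := realize_of_forall_real hM (groupLt (.var (0 : Fin 1)) (.var 0)).not (fun v => by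
    simp [realize_groupLt, real_groupLt]) (fun _ => x)
  simp only [Formula.realize_not, realize_groupLt] at this
  exact this

theorem lt_trans_of_model (hM : M ⊨ baseTheory) (x y z : M) (hxy : Structure.RelMap ltSymb ![x, y])
    (hyz : Structure.RelMap ltSymb ![y, z]) : Structure.RelMap ltSymb ![x, z] := by
  let := (LHom.sumInl : LGroup →ᴸ Lt).reduct M
  have := realize_of_forall_real hM ((groupLt (.var (0 : Fin 3)) (.var 1)).imp
    ((groupLt (.var 1) (.var 2)).imp (groupLt (.var 0) (.var 2)))) (fun v => by
      simpa only [Formula.realize_imp, realize_groupLt, real_groupLt, Term.realize_var]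
        using lt_trans) ![x, y, z]
  simp only [Formula.realize_imp, realize_groupLt] at this
  exact this hxy hyz

theorem lt_trichotomy_of_model (hM : M ⊨ baseTheory) (x y : M) :
    Structure.RelMap ltSymb ![x, y] ∨ x = y ∨ Structure.RelMap ltSymb ![y, x] := by
  let := (LHom.sumInl : LGroup →ᴸ Lt).reduct M
  have := realize_of_forall_real hM ((groupLt (.var (0 : Fin 2)) (.var 1)) ⊔
    (((Term.var 0).equal (.var 1)) ⊔ (groupLt (.var 1) (.var 0)))) (fun v => by
      simpa only [Formula.realize_sup, Formula.realize_equal, realize_groupLt, real_groupLt,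
        Term.realize_var] using lt_trichotomy _ _) ![x, y]
  simp only [Formula.realize_sup, Formula.realize_equal, realize_groupLt] at this
  exact this

theorem add_lt_add_left_of_model (hM : M ⊨ baseTheory) (x y z : M)
    (hxy : Structure.RelMap ltSymb ![x, y]) :
    Structure.RelMap ltSymb
      ![Structure.funMap addSymb ![z, x], Structure.funMap addSymb ![z, y] ] := by
  let := (LHom.sumInl : LGroup →ᴸ Lt).reduct M
  have := realize_of_forall_real hM ((groupLt (.var (0 : Fin 3)) (.var 1)).imp
    (groupLt (groupAdd (.var 2) (.var 0)) (groupAdd (.var 2) (.var 1)))) (fun v => by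
      simpa only [Formula.realize_imp, realize_groupLt, realize_groupAdd, real_groupLt,
        real_groupAdd, Term.realize_var] using fun h => (add_lt_add_iff_left _).2 h) ![x, y, z]
  simp only [Formula.realize_imp, realize_groupLt, realize_groupAdd] at this
  exact this hxy

theorem zero_lt_one_of_model (hM : M ⊨ baseTheory) :
    Structure.RelMap ltSymb
      ![(Structure.funMap zeroSymb ![] : M), Structure.funMap oneSymb ![] ] := by
  let := (LHom.sumInl : LGroup →ᴸ Lt).reduct M
  have := realize_of_forall_real hM (groupLt (α := Fin 0)
    (Term.func groupZeroSymb ![])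
    (Term.func groupOneSymb ![])) (fun v => by
      simp only [realize_groupLt, real_groupLt, Term.realize_func]
      exact zero_lt_one) ![]
  simp only [realize_groupLt, Term.realize_func, Matrix.empty_eq] at this
  exact this

/-- The vector space axioms supply the module, transfer from ℝ supplies the compatible order, and `0
< 1` gives nontriviality. -/
theorem exists_isScalarModel (hM : M ⊨ Tt) :
    ∃ (_ : AddCommGroup M) (_ : LinearOrder M) (_ : IsOrderedAddMonoid M)
      (_ : Module (RatFunc ℚ) M) (e : M),
      Nontrivial M ∧ IsScalarModel e ∧ DenseScalars (RatFunc ℚ) M := by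
  classical
  have hbase : M ⊨ baseTheory := hM.mono fun σ hσ => Or.inl (Or.inl hσ)
  have hvs : ∀ {k : ℕ} {φ : Lt.Formula (Fin k)}, VectorSpaceAxiom (univClosure k φ) →
      ∀ v : Fin k → M, φ.Realize v := fun {k φ} h =>
    (realize_univClosure M φ).1 (hM.realize_of_mem _ (Or.inl (Or.inr h)))
  have hdens : ∀ {m : ℕ} (q : Fin m → RatFunc ℚ), LinearIndependent ℚ q →
      M ⊨ densitySentence q := fun q hq => hM.realize_of_mem _ (Or.inr ⟨_, q, hq, rfl⟩)
  let : Zero M := ⟨Structure.funMap zeroSymb ![]⟩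
  let : Add M := ⟨fun x y => Structure.funMap addSymb ![x, y]⟩
  have hadd : ∀ x y : M, Structure.funMap addSymb ![x, y] = x + y := fun _ _ => rfl
  have hzero : (Structure.funMap zeroSymb ![] : M) = 0 := rfl
  have h_assoc : ∀ x y z : M, x + y + z = x + (y + z) := fun x y z => by
    have := hvs .add_assoc ![x, y, z]
    simp only [Formula.realize_equal, realize_addT, Term.realize_var, hadd] at this
    exact this
  have h_comm : ∀ x y : M, x + y = y + x := fun x y => by
    have := hvs .add_comm ![x, y]
    simp only [Formula.realize_equal, realize_addT, Term.realize_var, hadd] at this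
    exact this
  have h_zero : ∀ x : M, x + 0 = x := fun x => by
    have := hvs .add_zero ![x]
    simp only [Formula.realize_equal, realize_addT, realize_zeroT, Term.realize_var, hadd, hzero] at this
    exact this
  have h_neg : ∀ x : M, ∃ y, x + y = 0 := fun x => by
    have := hvs .exists_neg ![x]
    simp only [Formula.realize_iExs, Formula.realize_equal, realize_addT, realize_zeroT,
      Term.realize_var, hadd, hzero, Sum.elim_inl, Sum.elim_inr] at this
    obtain ⟨y, hy⟩ := this
    exact ⟨y 0, hy⟩
  choose neg hneg using h_neg
  let : Neg M := ⟨neg⟩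
  let instG : AddCommGroup M :=
    { AddGroup.ofLeftAxioms (G := M) h_assoc (fun x => (h_comm _ _).trans (h_zero x))
        (fun x => (h_comm _ _).trans (hneg x)) with
      add_comm := h_comm }
  let : SMul (RatFunc ℚ) M := ⟨fun q x => Structure.funMap (smulSymb q) ![x]⟩
  have hsmul : ∀ (q : RatFunc ℚ) (x : M), Structure.funMap (smulSymb q) ![x] = q • x :=
    fun _ _ => rfl
  have h_smul_add : ∀ (q : RatFunc ℚ) (x y : M), q • (x + y) = q • x + q • y := fun q x y => by
    have := hvs (.smul_add q) ![x, y]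
    simp only [Formula.realize_equal, realize_addT, realize_smulT, Term.realize_var, hadd, hsmul] at this
    exact this
  have h_add_smul : ∀ (p q : RatFunc ℚ) (x : M), (p + q) • x = p • x + q • x := fun p q x => by
    have := hvs (.add_smul p q) ![x]
    simp only [Formula.realize_equal, realize_addT, realize_smulT, Term.realize_var, hadd, hsmul] at this
    exact this
  have h_mul_smul : ∀ (p q : RatFunc ℚ) (x : M), (p * q) • x = p • q • x := fun p q x => by
    have := hvs (.mul_smul p q) ![x]
    simp only [Formula.realize_equal, realize_smulT, Term.realize_var, hsmul] at this
    exact this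
  have h_one_smul : ∀ x : M, (1 : RatFunc ℚ) • x = x := fun x => by
    have := hvs .one_smul ![x]
    simp only [Formula.realize_equal, realize_smulT, Term.realize_var, hsmul] at this
    exact this
  let instM : Module (RatFunc ℚ) M :=
    { smul_add := h_smul_add
      add_smul := h_add_smul
      mul_smul := h_mul_smul
      one_smul := h_one_smul
      -- Not among the axioms: additivity gives `q • 0 = q • 0 + q • 0`, and the group law cancels.
      smul_zero := fun q => by
        have := h_smul_add q 0 0
        rwa [add_zero, left_eq_add] at this
      zero_smul := fun x => by
        have := h_add_smul 0 0 x
        rwa [add_zero, left_eq_add] at this }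
  let r : M → M → Prop := fun x y => Structure.RelMap ltSymb ![x, y]
  have : IsStrictTotalOrder M r :=
    { irrefl := lt_irrefl_of_model hbase
      trans := lt_trans_of_model hbase
      trichotomous := fun x y hxy hyx => by
        rcases lt_trichotomy_of_model hbase x y with h | h | h
        exacts [absurd h hxy, h, absurd h hyx] }
  let instL : LinearOrder M := linearOrderOfSTO r
  have hlt : ∀ x y : M, Structure.RelMap ltSymb ![x, y] ↔ x < y := fun _ _ => Iff.rfl
  have instO : IsOrderedAddMonoid M :=
    { add_le_add_left := fun x y hxy z => by
        rcases hxy.lt_or_eq with h | rfl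
        · have := add_lt_add_left_of_model hbase x y z h
          rw [add_comm x, add_comm y]
          exact le_of_lt this
        · exact le_rfl }
  refine ⟨instG, instL, instO, instM, Structure.funMap oneSymb ![], ?_, ?_, ?_⟩
  · exact ⟨_, _, ne_of_lt ((hlt _ _).1 (zero_lt_one_of_model hbase))⟩
  · refine ⟨fun x => ?_, fun x => ?_, fun x => ?_, fun q x => ?_, fun x => ?_⟩
    · rw [Subsingleton.elim x ![] ]
      rfl
    · rw [Subsingleton.elim x ![] ]
    · rw [← vec_two_eta x]
      rfl
    · rw [← vec_one_eta x]
      rfl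
    · rw [← vec_two_eta x]
      rfl
  · intro m q hq a b hab
    exact (realize_densitySentence M q).1 (hdens q hq) a b hab

/-- Elimination holds within each model of `Tt`, so a shattering pattern is refuted in the very
model that carries it. -/
theorem theoryNIP_of_subset {T : Lt.Theory} (hT : Tt ⊆ T) : TheoryNIP T := by
  rintro m n φ ⟨M, a, b, h⟩
  obtain ⟨_, _, _, _, e, _, he, hd⟩ := exists_isScalarModel (M := M) (M.is_model.mono hT)
  let : Module ℚ M := Module.compHom M (algebraMap ℚ (RatFunc ℚ))
  exact ((he.isSemilinear_formula hd φ).fewTraces a b).not_shatters h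

end Model

/-! ### Axioms, definable closure and exchange in dense scalar models -/

section IsScalarModel

theorem apply_val_mem_span_of_mem_affine {V : Type*} [AddCommGroup V] [Module (RatFunc ℚ) V] {e : V}
    {S : Set V} {t : (S → V) → V} (ht : t ∈ affine e S) :
    t (fun s : S => (s : V)) ∈ Submodule.span (RatFunc ℚ) (insert e S) := by
  induction ht using Submodule.span_induction with
  | mem t ht =>
    obtain rfl | ⟨i, rfl⟩ := ht
    · exact Submodule.subset_span (Set.mem_insert _ _)
    · exact Submodule.subset_span (Set.mem_insert_of_mem _ i.2)
  | zero => exact Submodule.zero_mem _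
  | add s t _ _ hs ht => exact Submodule.add_mem _ hs ht
  | smul q t _ ht => exact Submodule.smul_mem _ q ht

variable {V : Type*} [AddCommGroup V] [LinearOrder V] [Module (RatFunc ℚ) V] [Lt.Structure V]
  {e : V}

theorem IsScalarModel.realize_vectorSpaceAxiom (he : IsScalarModel e) {σ : Lt.Sentence}
    (hσ : VectorSpaceAxiom σ) : V ⊨ σ := by
  cases hσ <;> rw [realize_univClosure] <;> intro v <;>
    simp only [Formula.realize_iExs, Formula.realize_equal, realize_addT, realize_zeroT,
      realize_smulT, Term.realize_var, he.add, he.zero, he.smul, Matrix.cons_val_zero,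
      Matrix.cons_val_one, Sum.elim_inl, Sum.elim_inr]
  case add_assoc => exact _root_.add_assoc _ _ _
  case add_comm => exact _root_.add_comm _ _
  case add_zero => exact _root_.add_zero _
  case exists_neg => exact ⟨fun _ => -v 0, add_neg_cancel _⟩
  case smul_add => exact _root_.smul_add _ _ _
  case add_smul => exact _root_.add_smul _ _ _
  case mul_smul => exact (smul_smul _ _ _).symm
  case one_smul => exact _root_.one_smul _ _

theorem IsScalarModel.realize_densitySentence (he : IsScalarModel e)
    (hd : DenseScalars (RatFunc ℚ) V) {m : ℕ} {q : Fin m → RatFunc ℚ}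
    (hq : LinearIndependent ℚ q) : V ⊨ densitySentence q := by
  rw [DenseGraph.realize_densitySentence]
  simp only [he.lt, he.smul, Matrix.cons_val_zero, Matrix.cons_val_one]
  exact hd m q hq

theorem IsScalarModel.exists_term_realize_eq (he : IsScalarModel e) {S : Set V} {b : V}
    (hb : b ∈ Submodule.span (RatFunc ℚ) (insert e S)) :
    ∃ t : Lt.Term S, t.realize (fun s : S => (s : V)) = b := by
  induction hb using Submodule.span_induction with
  | mem x hx =>
    obtain rfl | hx := hx
    · exact ⟨Term.func oneSymb ![], he.one _⟩
    · exact ⟨.var ⟨x, hx⟩, rfl⟩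
  | zero => exact ⟨Term.func zeroSymb ![], he.zero _⟩
  | add x y _ _ hx hy =>
    obtain ⟨s, rfl⟩ := hx
    obtain ⟨t, rfl⟩ := hy
    exact ⟨Term.func addSymb ![s, t], he.add _⟩
  | smul q x _ hx =>
    obtain ⟨t, rfl⟩ := hx
    exact ⟨Term.func (smulSymb q) ![t], he.smul q _⟩

variable [IsOrderedAddMonoid V] [Nontrivial V] [Module ℚ V]

/-- A formula defining `{b}` over `S` has `{b}` as its fibre over the tuple of all parameters, so
`b` is an affine function of that tuple. Conversely, elements of the span are values of terms; `e`
enters as the value of the symbol `1`. -/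
theorem IsScalarModel.mem_dcl_iff (he : IsScalarModel e) (hd : DenseScalars (RatFunc ℚ) V)
    {S : Set V} {b : V} : b ∈ dcl Lt S ↔ b ∈ Submodule.span (RatFunc ℚ) (insert e S) := by
  change S.Definable Lt {x : Fin 1 → V | x 0 ∈ ({b} : Set V)} ↔ _
  rw [Set.definable_iff_exists_formula_sum]
  constructor
  · rintro ⟨φ, hφ⟩
    have h1 := (he.isSemilinear_formula hd φ).preimage (W' := extendVar (affine e S))
      (fun z => Sum.elim z.1 fun _ => z.2)
      (comp_mem_of_mem_affine _ (mem_extendVar (const_mem_affine e _)) (by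
        rintro (i | i)
        · exact mem_extendVar (coord_mem_affine e i)
        · exact snd_mem_extendVar _))
    obtain ⟨t, ht, rfl⟩ := h1.exists_eq_of_fiber hd (x := fun s => (s : V)) (b := b) fun y =>
      (Set.ext_iff.1 hφ fun _ => y).symm
    exact apply_val_mem_span_of_mem_affine ht
  · intro hb
    obtain ⟨t, rfl⟩ := he.exists_term_realize_eq hb
    refine ⟨(Term.var (Sum.inr 0)).equal (t.relabel Sum.inl), ?_⟩
    ext x
    simp [Formula.realize_equal, Function.comp_def]

theorem IsScalarModel.exchangeProperty (he : IsScalarModel e) (hd : DenseScalars (RatFunc ℚ) V) :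
    ExchangeProperty Lt V := by
  rintro S a b ⟨ha, ha'⟩
  have hins : ∀ x, insert e (S ∪ {x}) = insert x (insert e S) := fun x => by
    rw [Set.union_singleton, Set.insert_comm]
  rw [he.mem_dcl_iff hd, hins] at ha ⊢
  rw [he.mem_dcl_iff hd] at ha'
  exact mem_span_insert_exchange ha ha'

end IsScalarModel

/-! ### Existence of the choices -/

open Cardinal in
theorem countable_ratFunc : Countable (RatFunc ℚ) := by
  have : Countable (Polynomial ℚ) := by
    rw [← mk_le_aleph0_iff]
    exact Polynomial.cardinalMk_le_max.trans (by simp)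
  refine Function.Surjective.countable (f := fun p : Polynomial ℚ × Polynomial ℚ =>
    algebraMap _ (RatFunc ℚ) p.1 / algebraMap _ (RatFunc ℚ) p.2) fun q => ?_
  exact ⟨(q.num, q.denom), q.num_div_denom⟩

/-- The scalar is a unit so that rescaling basis vectors again gives a basis. -/
theorem exists_rat_mul_mem_Ioo {b l r : ℝ} (hb : b ≠ 0) (h : l < r) :
    ∃ w : ℚˣ, w • b ∈ Set.Ioo l r := by
  -- Shrinking to an interval that misses `0` forces the rational factor to be nonzero.
  obtain ⟨l', hl', hl0⟩ : ∃ l', l ≤ l' ∧ l' < r ∧ (0 ≤ l' ∨ r ≤ 0) := by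
    rcases lt_or_ge 0 r with hr | hr
    · exact ⟨max l 0, le_max_left _ _, max_lt h hr, Or.inl (le_max_right _ _)⟩
    · exact ⟨l, le_rfl, h, Or.inr hr⟩
  have key : ∃ q : ℚ, (q : ℝ) * b ∈ Set.Ioo l' r := by
    rcases lt_or_gt_of_ne hb with hb | hb
    · obtain ⟨q, h1, h2⟩ := exists_rat_btwn ((div_lt_div_right_of_neg hb).2 hl0.1)
      exact ⟨q, (lt_div_iff_of_neg hb).1 h2, (div_lt_iff_of_neg hb).1 h1⟩
    · obtain ⟨q, h1, h2⟩ := exists_rat_btwn ((div_lt_div_iff_of_pos_right hb).2 hl0.1)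
      exact ⟨q, (div_lt_iff₀ hb).1 h1, (lt_div_iff₀ hb).1 h2⟩
  obtain ⟨q, hq⟩ := key
  have hq0 : q ≠ 0 := by
    rintro rfl
    simp only [Rat.cast_zero, zero_mul, Set.mem_Ioo] at hq
    rcases hl0.2 with h0 | h0
    · exact absurd hq.1 (not_lt.2 h0)
    · exact absurd hq.2 (not_lt.2 h0)
  refine ⟨Units.mk0 q hq0, ?_⟩
  rw [Units.smul_mk0, Rat.smul_def]
  exact ⟨hl'.trans_lt hq.1, hq.2⟩

/-- There is an enumeration by `2 ^ ℵ₀` of families of intervals which realizes every finite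
partial family with rational endpoints. -/
theorem exists_interval_family (I : Type) [Countable I] :
    ∃ J : (ℕ → Bool) → I → ℚ × ℚ, ∀ (m : ℕ) (p : Fin m → I) (w : Fin m → ℚ × ℚ),
      Function.Injective p → ∃ γ, ∀ i, J γ (p i) = w i := by
  classical
  obtain ⟨F, hF⟩ := exists_surjective_nat (I →₀ ℚ × ℚ)
  -- `F` enumerates the countably many finitely supported families; `γ` selects the one indexed by
  -- its first `true`, so the indicator of `n` selects the `n`-th.
  refine ⟨fun γ i => F (sInf {n | γ n = true}) i, fun m p w hp => ?_⟩
  obtain ⟨n, hn⟩ := hF (Finsupp.embDomain ⟨p, hp⟩ (Finsupp.equivFunOnFinite.symm w))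
  refine ⟨fun k => decide (k = n), fun i => ?_⟩
  have h1 : sInf {k | decide (k = n) = true} = n := by simp
  simp only [h1, hn]
  exact (Finsupp.embDomain_apply_self ⟨p, hp⟩ _ i).trans rfl

open Cardinal in
-- A ℚ-basis of ℝ has the cardinality of `(ℕ → Bool) × I`, so it can be indexed by these pairs.
-- Rescaling the vector at `(γ, p)` into the interval `J γ p` gives `f γ p`. Injectivity and
-- disjointness come from the indexing, density from the richness of `J`.
theorem nonempty_choices : Nonempty Choices := by
  classical
  have := countable_ratFunc
  have h1 : LinearIndepOn ℚ id ({1} : Set (RatFunc ℚ)) := by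
    simp
  let I : Set (RatFunc ℚ) := h1.extend (Set.subset_univ _)
  have hI1 : (1 : RatFunc ℚ) ∈ I := h1.subset_extend _ rfl
  let bI := Module.Basis.extend h1
  obtain ⟨J, hJ⟩ := exists_interval_family I
  let b₀ := Module.Basis.ofVectorSpace ℚ ℝ
  have hcard : #((ℕ → Bool) × I) = #(Module.Basis.ofVectorSpaceIndex ℚ ℝ) := by
    have : Nonempty I := ⟨⟨1, hI1⟩⟩
    rw [b₀.mk_eq_rank'', Real.rank_rat_real, mk_prod]
    simp only [mk_pi, mk_bool, prod_const, lift_id, mk_nat]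
    rw [two_power_aleph0]
    exact mul_eq_left aleph0_le_continuum ((mk_le_aleph0 (α := I)).trans aleph0_le_continuum)
      (mk_ne_zero _)
  obtain ⟨e⟩ := Cardinal.eq.1 hcard
  let b₁ := b₀.reindex e.symm
  -- Pairs that bound no interval leave the vector unscaled.
  have hw : ∀ x : (ℕ → Bool) × I, ∃ w : ℚˣ, (J x.1 x.2).1 < (J x.1 x.2).2 →
      w • b₁ x ∈ Set.Ioo ((J x.1 x.2).1 : ℝ) (J x.1 x.2).2 := fun x => by
    by_cases h : (J x.1 x.2).1 < (J x.1 x.2).2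
    · obtain ⟨w, hw⟩ := exists_rat_mul_mem_Ioo (b₁.ne_zero x) (Rat.cast_lt (K := ℝ).2 h)
      exact ⟨w, fun _ => hw⟩
    · exact ⟨1, fun h' => absurd h' h⟩
  choose w hw using hw
  let b := b₁.unitsSMul w
  have hb : ∀ x, (J x.1 x.2).1 < (J x.1 x.2).2 →
      b x ∈ Set.Ioo ((J x.1 x.2).1 : ℝ) (J x.1 x.2).2 := fun x hx => by
    rw [Module.Basis.unitsSMul_apply]
    exact hw x hx
  have hdense : ∀ (m : ℕ) (l r : Fin m → ℝ) (p : Fin m → I), (∀ i, l i < r i) →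
      Function.Injective p → ∃ γ, ∀ i, b (γ, p i) ∈ Set.Ioo (l i) (r i) := by
    intro m l r p hlr hp
    have hq : ∀ i, ∃ q : ℚ × ℚ, l i < q.1 ∧ q.1 < q.2 ∧ (q.2 : ℝ) < r i := fun i => by
      obtain ⟨q, h1, h2⟩ := exists_rat_btwn (hlr i)
      obtain ⟨q', h3, h4⟩ := exists_rat_btwn h2
      exact ⟨(q, q'), h1, Rat.cast_lt.1 h3, h4⟩
    choose q hq using hq
    obtain ⟨γ, hγ⟩ := hJ m p q hp
    refine ⟨γ, fun i => ?_⟩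
    have h := hb (γ, p i)
    simp only [hγ i] at h
    have h := h (hq i).2.1
    exact ⟨(hq i).1.trans h.1, h.2.trans (hq i).2.2⟩
  refine ⟨{
    B := Set.range b
    B_dense := ?_
    B_indep := b.linearIndependent.linearIndepOn_id
    B_span := ?_
    I := I
    one_mem_I := hI1
    I_indep := ?_
    I_span := ?_
    f := fun γ p => ⟨b (γ, p), ⟨_, rfl⟩⟩
    f_cover := ?_
    f_injective := ?_
    f_disjoint := ?_
    f_dense := hdense }⟩
  -- Density of `B` is the case of the single index `1 ∈ I`.
  · refine dense_of_exists_between fun l r hlr => ?_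
    obtain ⟨γ, hγ⟩ := hdense 1 (fun _ => l) (fun _ => r) (fun _ => ⟨1, hI1⟩) (fun _ => hlr)
      (Function.injective_of_subsingleton _)
    exact ⟨_, ⟨_, rfl⟩, hγ 0⟩
  · rw [Subtype.range_coe, b.span_eq]
  · exact h1.linearIndepOn_extend _
  · have := bI.span_eq
    rw [Module.Basis.range_extend] at this
    rw [Subtype.range_coe]
    exact this.ge
  · ext ⟨_, ⟨γ, p⟩, rfl⟩
    simp only [Set.mem_iUnion, Set.mem_univ, iff_true]
    exact ⟨γ, p, rfl⟩
  · intro γ p p' h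
    have := b.injective (Subtype.ext_iff.1 h)
    exact (Prod.ext_iff.1 this).2
  · intro γ η hne
    ext x
    simp only [Set.mem_inter_iff, Set.mem_range, Set.mem_empty_iff_false, iff_false, not_and]
    rintro ⟨p, rfl⟩ ⟨p', h⟩
    have := b.injective (Subtype.ext_iff.1 h)
    exact hne (Prod.ext_iff.1 this).1.symm

/-! ### The structure on the real numbers -/

namespace Choices

variable (c : Choices)

/-- The scalar multiplication `λ` as a module structure on `ℝ`. -/
@[reducible]
def realModule : Module (RatFunc ℚ) ℝ where
  smul := c.lam
  one_smul a := by
    change c.sumMap ((1 : RatFunc ℚ) • c.sumEquiv.symm a) = a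
    rw [one_smul]
    exact c.sumEquiv.apply_symm_apply a
  mul_smul p q a := by
    change c.sumMap ((p * q) • c.sumEquiv.symm a) =
      c.sumMap (p • c.sumEquiv.symm (c.sumEquiv (q • c.sumEquiv.symm a)))
    rw [c.sumEquiv.symm_apply_apply, mul_smul]
  smul_zero q := by
    change c.sumMap (q • c.sumEquiv.symm 0) = 0
    rw [map_zero, smul_zero, map_zero]
  smul_add q a b := by
    change c.sumMap (q • c.sumEquiv.symm (a + b)) =
      c.sumMap (q • c.sumEquiv.symm a) + c.sumMap (q • c.sumEquiv.symm b)
    rw [map_add, smul_add, map_add]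
  add_smul p q a := by
    change c.sumMap ((p + q) • c.sumEquiv.symm a) =
      c.sumMap (p • c.sumEquiv.symm a) + c.sumMap (q • c.sumEquiv.symm a)
    rw [add_smul, map_add]
  zero_smul a := by
    change c.sumMap ((0 : RatFunc ℚ) • c.sumEquiv.symm a) = 0
    rw [zero_smul, map_zero]

/-- In the decomposition of ℝ, `f_γ(1)` is the vector with sole entry `1` at `γ`. All its multiples
are thus values of `f_γ`, which makes it the witness for density. -/
theorem smul_f_one (q : RatFunc ℚ) (γ : ℕ → Bool) :
    letI := c.realModule
    q • ((c.f γ ⟨1, c.one_mem_I⟩ : c.B) : ℝ) = c.fLin γ q := by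
  have h1 : ∀ p, c.sumEquiv (Finsupp.single γ p) = c.fLin γ p := fun p => by
    change c.sumMap _ = _
    simp [sumMap]
  have h2 : c.fLin γ 1 = c.f γ ⟨1, c.one_mem_I⟩ := by
    have : (1 : RatFunc ℚ) = c.basisI ⟨1, c.one_mem_I⟩ := by simp [basisI]
    conv_lhs => rw [this]
    rw [fLin, Module.Basis.constr_basis]
  have h3 : c.sumEquiv.symm (c.f γ ⟨1, c.one_mem_I⟩ : c.B) = Finsupp.single γ 1 := by
    rw [LinearEquiv.symm_apply_eq, h1, h2]
  change c.sumMap (q • c.sumEquiv.symm _) = _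
  rw [h3, Finsupp.smul_single, smul_eq_mul, mul_one]
  exact h1 q

/-- Neighbourhoods in the product topology restrict only finitely many coordinates, so `f_dense`
says that the functions `f γ` are dense in `I → ℝ`. -/
theorem exists_f_mem {y : c.I → ℝ} {U : Set (c.I → ℝ)} (hU : U ∈ nhds y) :
    ∃ γ, (fun p => (c.f γ p : ℝ)) ∈ U := by
  rw [nhds_pi, Filter.mem_pi'] at hU
  obtain ⟨J, t, ht, hJ⟩ := hU
  choose l r hlr using fun p => mem_nhds_iff_exists_Ioo_subset.1 (ht p)
  obtain ⟨γ, hγ⟩ := c.f_dense _ (fun i => l (J.equivFin.symm i)) (fun i => r (J.equivFin.symm i))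
    (fun i => (J.equivFin.symm i : c.I)) (fun i => (hlr _).1.1.trans (hlr _).1.2)
    (Subtype.val_injective.comp J.equivFin.symm.injective)
  refine ⟨γ, hJ fun p hp => (hlr p).2 ?_⟩
  simpa using hγ (J.equivFin ⟨p, hp⟩)

/-- By linear independence some ℚ-linear `g : ℚ(t) → ℝ` sends each `q i` into its interval. The
values at the `q i` depend continuously on the restriction to `I`, so some `f_γ` near `g` there does
the same, and `x = f_γ(1)` works. -/
theorem denseScalars :
    letI := c.realModule
    DenseScalars (RatFunc ℚ) ℝ := by
  classical
  let := c.realModule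
  intro m q hq a b hab
  obtain ⟨g, hg⟩ : ∃ g : RatFunc ℚ →ₗ[ℚ] ℝ, ∀ i, a i < g (q i) ∧ g (q i) < b i := by
    choose z hz using fun i => exists_between (hab i)
    obtain ⟨g, hg⟩ := LinearMap.exists_extend ((Module.Basis.span hq).constr ℚ z)
    refine ⟨g, fun i => ?_⟩
    have h1 := LinearMap.congr_fun hg (Module.Basis.span hq i)
    rw [Module.Basis.constr_basis, LinearMap.comp_apply, Submodule.subtype_apply,
      Module.Basis.span_apply] at h1
    rw [h1]
    exact hz i
  -- Only these basis elements occur in the `q i`, so evaluation at each `q i` is a finite sum of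
  -- coordinates.
  let s : Finset c.I := Finset.univ.biUnion fun i => (c.basisI.repr (q i)).support
  have hsum : ∀ (h : RatFunc ℚ →ₗ[ℚ] ℝ) (i : Fin m),
      h (q i) = ∑ p ∈ s, (c.basisI.repr (q i) p : ℝ) * h (c.basisI p) := fun h i => by
    conv_lhs => rw [← c.basisI.linearCombination_repr (q i), Finsupp.linearCombination_apply]
    rw [Finsupp.sum_of_support_subset _ (Finset.subset_biUnion_of_mem
      (fun i => (c.basisI.repr (q i)).support) (Finset.mem_univ i)) _ (by simp), map_sum]
    exact Finset.sum_congr rfl fun p _ => by rw [h.map_smul, Rat.smul_def]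
  have hev : {y : c.I → ℝ | ∀ i, ∑ p ∈ s, (c.basisI.repr (q i) p : ℝ) * y p ∈ Set.Ioo (a i) (b i)}
      ∈ nhds fun p => g (c.basisI p) := by
    refine Filter.eventually_all.2 fun i => ?_
    have hc : Continuous fun y : c.I → ℝ => ∑ p ∈ s, (c.basisI.repr (q i) p : ℝ) * y p := by
      fun_prop
    refine hc.continuousAt.eventually (isOpen_Ioo.mem_nhds ?_)
    have := hg i
    rwa [hsum] at this
  obtain ⟨γ, hγ⟩ := c.exists_f_mem hev
  refine ⟨(c.f γ ⟨1, c.one_mem_I⟩ : c.B), fun i => ?_⟩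
  rw [c.smul_f_one, hsum]
  have h1 : ∀ p, c.fLin γ (c.basisI p) = c.f γ p := fun p => by
    rw [fLin, Module.Basis.constr_basis]
  simp only [h1]
  exact hγ i

theorem isScalarModel :
    letI := c.realModule
    letI := c.Rt
    IsScalarModel (1 : ℝ) := by
  let := c.realModule
  let := c.Rt
  exact ⟨fun _ => rfl, fun _ => rfl, fun _ => rfl, fun _ _ => rfl, fun _ => Iff.rfl⟩

theorem model_Tt :
    letI := c.Rt
    ℝ ⊨ Tt := by
  let := c.realModule
  let := c.Rt
  rw [Theory.model_iff]
  rintro σ ((hσ | hσ) | ⟨m, q, hq, rfl⟩)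
  · have : ℝ ⊨ baseTheory :=
      (LHom.onTheory_model (M := ℝ) (LHom.sumInl : LGroup →ᴸ Lt) _).2 inferInstance
    exact this.realize_of_mem _ hσ
  · exact c.isScalarModel.realize_vectorSpaceAxiom hσ
  · exact c.isScalarModel.realize_densitySentence c.denseScalars hq

end Choices

/-! ### Definable completeness, failure of o-minimality, and the counterexample -/

theorem definablyComplete_real (L : FirstOrder.Language.{0, 0}) [L.Structure ℝ] :
    DefinablyComplete L ℝ :=
  fun _ _ => ⟨⟨_, isLUB_sSup _⟩, ⟨_, isGLB_sInf _⟩⟩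

theorem linearIndependent_one_X : LinearIndependent ℚ ![(1 : RatFunc ℚ), RatFunc.X] := by
  rw [LinearIndependent.pair_iff]
  intro s t h
  have h1 : algebraMap (Polynomial ℚ) (RatFunc ℚ)
      (Polynomial.C s + Polynomial.C t * Polynomial.X) = 0 := by
    rw [map_add, map_mul, RatFunc.algebraMap_X, RatFunc.algebraMap_C, RatFunc.algebraMap_C, ← h]
    rw [Rat.smul_def, Rat.smul_def, mul_one, eq_ratCast, eq_ratCast]
  rw [map_eq_zero_iff _ (RatFunc.algebraMap_injective ℚ)] at h1
  exact ⟨by simpa using congrArg (Polynomial.coeff · 0) h1,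
    by simpa using congrArg (Polynomial.coeff · 1) h1⟩

/-- The set `S` where `X • x` is positive is infinite, so a finite decomposition would include an
infinite interval inside `S`. The pairs `(x, X • x)` are dense in the plane, so that interval also
contains a point with `X • x` negative. -/
theorem Choices.not_oMinimal (c : Choices) :
    letI := c.Rt
    ¬ OMinimal Lt ℝ := by
  let := c.realModule
  let := c.Rt
  intro h
  let S : Set ℝ := {x | 0 < (RatFunc.X : RatFunc ℚ) • x}
  have hS : (Set.univ : Set ℝ).Definable₁ Lt S := by
    have h1 : (∅ : Set ℝ).Definable Lt {x : Fin 1 → ℝ | x 0 ∈ S} := by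
      rw [Set.empty_definable_iff]
      refine ⟨ltF zeroT (smulT RatFunc.X (.var 0)), ?_⟩
      ext x
      simp only [Set.mem_ofPred_eq, realize_ltF, realize_zeroT, realize_smulT, Term.realize_var]
      exact Iff.rfl
    exact h1.mono (Set.empty_subset _)
  have hdense : ∀ (a b a' b' : ℝ), a < b → a' < b' → ∃ x, (a < x ∧ x < b) ∧
      (a' < (RatFunc.X : RatFunc ℚ) • x ∧ (RatFunc.X : RatFunc ℚ) • x < b') := by
    intro a b a' b' hab hab'
    obtain ⟨x, hx⟩ := c.denseScalars 2 _ linearIndependent_one_X ![a, a'] ![b, b'] (by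
      intro i
      fin_cases i
      exacts [hab, hab'])
    have h0 := hx 0
    have h1 := hx 1
    simp only [Matrix.cons_val_zero, Matrix.cons_val_one, one_smul] at h0 h1
    exact ⟨x, h0, h1⟩
  -- `S` is dense, and a finite dense set, being closed, would be all of ℝ.
  have hSinf : S.Infinite := by
    intro hfin
    have hd : Dense S := dense_of_exists_between fun a b hab => by
      obtain ⟨x, hx, hx'⟩ := hdense a b 0 1 hab one_pos
      exact ⟨x, hx'.1, hx⟩
    have h1 := hfin.isClosed.closure_eq
    rw [hd.closure_eq] at h1
    exact Set.infinite_univ (h1 ▸ hfin)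
  obtain ⟨F, hF, hSF, hFI⟩ := h S hS
  obtain ⟨I, hI, hIinf⟩ : ∃ I ∈ F, I.Infinite := by
    by_contra! hcon
    rw [hSF] at hSinf
    exact hSinf (hF.sUnion hcon)
  rcases hFI I hI with ⟨a, rfl⟩ | ⟨l, r, rfl⟩
  · exact hIinf (Set.finite_singleton a)
  · obtain ⟨x, hx, y, hy, hxy⟩ := hIinf.nontrivial.exists_lt
    obtain ⟨z, hz, hz'⟩ := hdense x y (-1) 0 hxy (by norm_num)
    have hmono : ∀ {u v : ℝ}, u < v → toExt u < toExt v := fun h =>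
      WithBot.coe_lt_coe.2 (WithTop.coe_lt_coe.2 h)
    have hzS : z ∈ S := by
      rw [hSF]
      exact ⟨_, hI, hx.1.trans (hmono hz.1), (hmono hz.2).trans hy.2⟩
    exact absurd hz'.2 (not_lt.2 (le_of_lt hzS))

theorem Choices.structureNIP (c : Choices) :
    letI := c.Rt
    StructureNIP Lt ℝ := by
  let := c.Rt
  exact theoryNIP_of_subset fun σ hσ => c.model_Tt.realize_of_mem σ hσ

theorem Choices.exchangeProperty (c : Choices) :
    letI := c.Rt
    ExchangeProperty Lt ℝ := by
  let := c.realModule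
  let := c.Rt
  exact c.isScalarModel.exchangeProperty c.denseScalars

theorem not_everyDCEPNIPExpansionIsOMinimal : ¬ EveryDCEPNIPExpansionIsOMinimal := by
  intro h
  obtain ⟨c⟩ := nonempty_choices
  let := c.Rt
  exact c.not_oMinimal (h Lt ℝ ⟨ltSymb, fun _ => Iff.rfl⟩ ⟨addSymb, fun _ => rfl⟩
    (definablyComplete_real Lt) c.exchangeProperty c.structureNIP)

end DenseGraph

end

theorem mainTheorem4 :
    -- every completion of `T_t` has NIP
    (∀ T' : DenseGraph.Lt.Theory, DenseGraph.Tt ⊆ T' → T'.IsComplete → DenseGraph.TheoryNIP T') ∧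
    -- the structure `R_t` can be constructed
    Nonempty DenseGraph.Choices ∧
    -- `R_t` is a model of `T_t`, satisfies DC, EP and NIP, and is not o-minimal
    (∀ c : DenseGraph.Choices, letI : DenseGraph.Lt.Structure ℝ := c.Rt
      ℝ ⊨ DenseGraph.Tt ∧
      DenseGraph.DefinablyComplete DenseGraph.Lt ℝ ∧
      DenseGraph.ExchangeProperty DenseGraph.Lt ℝ ∧
      DenseGraph.StructureNIP DenseGraph.Lt ℝ ∧
      ¬ DenseGraph.OMinimal DenseGraph.Lt ℝ) ∧
    -- DC, EP and NIP do not force an expansion of an ordered group to be o-minimal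
    ¬ DenseGraph.EveryDCEPNIPExpansionIsOMinimal :=
  ⟨fun _ hT _ => DenseGraph.theoryNIP_of_subset hT, DenseGraph.nonempty_choices,
    fun c => ⟨c.model_Tt, @DenseGraph.definablyComplete_real _ c.Rt, c.exchangeProperty,
      c.structureNIP, c.not_oMinimal⟩,
    DenseGraph.not_everyDCEPNIPExpansionIsOMinimal⟩
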